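/- Let $M,N\ge 0$ be integers, and put $|i|=0$ for $1\le i\le M$ and $|i|=1$ for $M<i\le M+N$ (the standard $0^M1^N$-sequence). Let $Y_{M|N}$ be the super Yangian: the unital associative superalgebra over $\mathbb C$ with generators $t_{i,j}^{(r)}$ ($1\le i,j\le M+N$, $r\ge1$) of parity $|i|+|j|$ and relations $$[t_{i,j}^{(r)},t_{k,l}^{(s)}]=(-1)^{|i||j|+|i||k|+|j||k|}\sum_{t=0}^{\min(r,s)-1}\bigl(t_{k,j}^{(t)}t_{i,l}^{(r+s-1-t)}-t_{k,j}^{(r+s-1-t)}t_{i,l}^{(t)}\bigr),$$ where $[\cdot,\cdot]$ is the supercommutator and $t_{i,j}^{(0)}=\delta_{ij}$. Let $t_{i,j}(u)=\sum_{r\ge0}t_{i,j}^{(r)}u^{-r}\in Y_{M|N}[[u^{-1}]]$, $T(u)=(t_{i,j}(u))_{i,j}$ and $T(u)^{-1}=(t'_{i,j}(u))_{i,j}$. The quantum Berezinian is $$\operatorname{qsdet}T(u)=\sum_{\rho\in S_M}\operatorname{sgn}(\rho)\,t_{\rho(1),1}(u)\,t_{\rho(2),2}(u-1)\cdots t_{\rho(M),M}(u-M+1)\times\sum_{\sigma\in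 S_N}\operatorname{sgn}(\sigma)\,t'_{M+1,M+\sigma(1)}(u-M+1)\cdots t'_{M+N,M+\sigma(N)}(u-M+N).$$ For an $\ell\times\ell$ matrix $X(u)=(x_{i,j}(u))$ over $Y_{M|N}[[u^{-1}]]$ let $$\operatorname{qdet}X(u)=\sum_{\sigma\in S_\ell}\operatorname{sgn}(\sigma)\,x_{\sigma(1),1}(u)\,x_{\sigma(2),2}(u-1)\cdots x_{\sigma(\ell),\ell}(u-\ell+1).$$ Let $\lambda=(\lambda_1,\dots,\lambda_m)$ be a composition of $M$ and $\nu=(\nu_1,\dots,\nu_n)$ a composition of $N$ (with positive parts), put $p_a(\lambda)=\lambda_1+\cdots+\lambda_{a-1}$ and $p_b(\nu)=\nu_1+\cdots+\nu_{b-1}$, and let $\mu=(\lambda_1,\dots,\lambda_m\mid\nu_1,\dots,\nu_n)$. Let $T(u)=F(u)D(u)E(u)$ be the (unique) block Gauss decomposition with respect to $\mu$: $D(u)$ is block diagonal with diagonal blocks $D_1(u),\dots,D_{m+n}(u)$ of sizes $\lambda_1,\dots,\lambda_m,\nu_1,\dots,\nu_n$, and $F(u)$, $E(u)$ are block lower,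 respectively upper, triangular with identity diagonal blocks and with off-diagonal blocks having entries in $u^{-1}Y_{M|N}[[u^{-1}]]$. Put $D'_a(u)=D_a(u)^{-1}$. Then $$\operatorname{qsdet}T(u)=\operatorname{qdet}D_1(u-p_1(\lambda))\,\operatorname{qdet}D_2(u-p_2(\lambda))\cdots\operatorname{qdet}D_m(u-p_m(\lambda))\times\operatorname{qdet}D'_{m+1}(u-M+p_2(\nu))\,\operatorname{qdet}D'_{m+2}(u-M+p_3(\nu))\cdots\operatorname{qdet}D'_{m+n}(u-M+p_{n+1}(\nu)),$$ where $p_{n+1}(\nu)=N$. -/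

import Mathlib

open PowerSeries

/-! ### The super Yangian, by generators and relations -/

namespace SuperYangian

/-- `preGen i j r` is the symbol `t_{i,j}^{(r)}` in the free algebra: `t_{i,j}^{(0)} = δ_{i,j}`, and
the `t_{i,j}^{(r)}` with `r ≥ 1` are the free generators, the one labelled `(i, j, r)` being
`t_{i,j}^{(r+1)}`. -/
noncomputable def preGen {k : ℕ} (i j : Fin k) : ℕ → FreeAlgebra ℂ (Fin k × Fin k × ℕ)
  | 0 => if i = j then 1 else 0
  | r + 1 => FreeAlgebra.ι ℂ (i, j, r)

/-- The defining relations for a `01`-sequence `s`, where `|i|` is the `i`-th digit of `s`, the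
generator `t_{i,j}^{(r)}` has parity `|i| + |j|`, and the left-hand side is the supercommutator
`[x, y] = x y - (-1)^{|x||y|} y x` of two generators. -/
inductive Rel {k : ℕ} (s : Fin k → Fin 2) :
    FreeAlgebra ℂ (Fin k × Fin k × ℕ) → FreeAlgebra ℂ (Fin k × Fin k × ℕ) → Prop
  | rtt (i j h l : Fin k) (r q : ℕ) (hr : 1 ≤ r) (hq : 1 ≤ q) :
      Rel s
        (preGen i j r * preGen h l q -
          (-1) ^ (((s i : ℕ) + (s j : ℕ)) * ((s h : ℕ) + (s l : ℕ))) *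
            (preGen h l q * preGen i j r))
        ((-1) ^ ((s i : ℕ) * (s j : ℕ) + (s i : ℕ) * (s h : ℕ) + (s j : ℕ) * (s h : ℕ)) *
          ∑ t ∈ Finset.range (min r q),
            (preGen h j t * preGen i l (r + q - 1 - t) -
              preGen h j (r + q - 1 - t) * preGen i l t))

end SuperYangian

/-- The (underlying associative unital `ℂ`-algebra of the) super Yangian of a `01`-sequence `s`. -/
def SuperYangian {k : ℕ} (s : Fin k → Fin 2) : Type :=
  RingQuot (SuperYangian.Rel s)

namespace SuperYangian

noncomputable instance {k : ℕ} (s : Fin k → Fin 2) : Ring (SuperYangian s) :=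
  inferInstanceAs (Ring (RingQuot (Rel s)))

noncomputable instance {k : ℕ} (s : Fin k → Fin 2) : Algebra ℂ (SuperYangian s) :=
  inferInstanceAs (Algebra ℂ (RingQuot (Rel s)))

/-- The quotient map from the free algebra. -/
noncomputable def mkHom {k : ℕ} (s : Fin k → Fin 2) :
    FreeAlgebra ℂ (Fin k × Fin k × ℕ) →ₐ[ℂ] SuperYangian s :=
  RingQuot.mkAlgHom ℂ (Rel s)

/-- The element `t_{i,j}^{(r)}` of the super Yangian, `r ≥ 0`. -/
noncomputable def gen {k : ℕ} (s : Fin k → Fin 2) (i j : Fin k) (r : ℕ) : SuperYangian s :=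
  mkHom s (preGen i j r)

/-- The standard sequence `0 … 0 1 … 1` with `M` zeros followed by `N` ones. -/
def stdSeq (M N : ℕ) : Fin (M + N) → Fin 2 := fun i => if (i : ℕ) < M then 0 else 1

/-! ### Power series in `u⁻¹`

A series `f(u) = ∑ f_r u^{-r}` with coefficients in `A` is an element of `A⟦X⟧` with `X = u⁻¹`. -/

/-- `f(u) ↦ f(u + a)`, where `(u + a)⁻¹` is expanded as
`u⁻¹ (1 - a u⁻¹ + a² u⁻² - …)` and `f(u + a) = ∑ f_r ((u + a)⁻¹)^r`. -/
noncomputable def shift {A : Type*} [Ring A] [Algebra ℂ A] (a : ℂ) (f : A⟦X⟧) : A⟦X⟧ :=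
  PowerSeries.mk fun n => ∑ r ∈ Finset.range (n + 1),
    coeff n ((X * PowerSeries.mk fun m => (-a) ^ m : ℂ⟦X⟧) ^ r) • coeff r f

/-- The matrix `T(u) = (t_{i,j}(u))`, `t_{i,j}(u) = ∑_{r ≥ 0} t_{i,j}^{(r)} u^{-r}`. -/
noncomputable def tMatrix {k : ℕ} (s : Fin k → Fin 2) :
    Matrix (Fin k) (Fin k) (SuperYangian s)⟦X⟧ :=
  Matrix.of fun i j => PowerSeries.mk fun r => gen s i j r

/-- The quantum determinant
`∑_σ sgn(σ) x_{σ(1),1}(u) x_{σ(2),2}(u-1) ⋯ x_{σ(ℓ),ℓ}(u-ℓ+1)` (factors in this order). -/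
noncomputable def qdet {A : Type*} [Ring A] [Algebra ℂ A] {ℓ : ℕ}
    (x : Matrix (Fin ℓ) (Fin ℓ) A⟦X⟧) : A⟦X⟧ :=
  ∑ σ : Equiv.Perm (Fin ℓ), Equiv.Perm.sign σ •
    (List.ofFn fun j : Fin ℓ => shift (-((j : ℕ) : ℂ)) (x (σ j) j)).prod

/-! ### Matrices of power series that are the identity at `u = ∞` -/

/-- A matrix of power series, as a power series of matrices. -/
noncomputable def matSeries {A : Type*} [Ring A] {k : ℕ} :
    Matrix (Fin k) (Fin k) A⟦X⟧ ≃+* (Matrix (Fin k) (Fin k) A)⟦X⟧ where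
  toFun P := PowerSeries.mk fun r => P.map (coeff r)
  invFun f := Matrix.of fun i j => PowerSeries.mk fun r => coeff r f i j
  left_inv P := by ext i j r; simp
  right_inv f := by ext r i j; simp
  map_mul' P Q := by
    ext r i j
    simp only [coeff_mk, coeff_mul, Matrix.map_apply, Matrix.mul_apply, map_sum,
      Matrix.sum_apply]
    exact Finset.sum_comm
  map_add' P Q := by ext r i j; simp

theorem coeff_matSeries {A : Type*} [Ring A] {k : ℕ} (P : Matrix (Fin k) (Fin k) A⟦X⟧) (r : ℕ)
    (i j : Fin k) : coeff r (matSeries P) i j = coeff r (P i j) := by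
  simp [matSeries]

theorem constantCoeff_matSeries {A : Type*} [Ring A] {k : ℕ}
    {P : Matrix (Fin k) (Fin k) A⟦X⟧}
    (hP : ∀ i j, constantCoeff (P i j) = if i = j then 1 else 0) :
    constantCoeff (matSeries P) = 1 := by
  ext i j
  rw [← coeff_zero_eq_constantCoeff_apply, coeff_matSeries, coeff_zero_eq_constantCoeff_apply, hP,
    Matrix.one_apply]

theorem isUnit_of_constantCoeff {A : Type*} [Ring A] {k : ℕ}
    {P : Matrix (Fin k) (Fin k) A⟦X⟧}
    (hP : ∀ i j, constantCoeff (P i j) = if i = j then 1 else 0) : IsUnit P := by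
  have h : IsUnit (matSeries P) := by
    rw [PowerSeries.isUnit_iff_constantCoeff, constantCoeff_matSeries hP]
    exact isUnit_one
  simpa using h.map (matSeries (A := A) (k := k)).symm

theorem constantCoeff_tMatrix {k : ℕ} (s : Fin k → Fin 2) (i j : Fin k) :
    constantCoeff (tMatrix s i j) = if i = j then 1 else 0 := by
  have h : constantCoeff (tMatrix s i j) = gen s i j 0 := by
    rw [← coeff_zero_eq_constantCoeff_apply, tMatrix, Matrix.of_apply, coeff_mk]
  rw [h, gen, preGen]
  split_ifs <;> simp

theorem isUnit_tMatrix {k : ℕ} (s : Fin k → Fin 2) : IsUnit (tMatrix s) :=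
  isUnit_of_constantCoeff (constantCoeff_tMatrix s)

/-- The inverse matrix `T(u)⁻¹ = (t'_{i,j}(u))`. -/
noncomputable def tInv {k : ℕ} (s : Fin k → Fin 2) :
    Matrix (Fin k) (Fin k) (SuperYangian s)⟦X⟧ :=
  ((isUnit_tMatrix s).unit⁻¹ : (Matrix (Fin k) (Fin k) (SuperYangian s)⟦X⟧)ˣ)

/-- The quantum Berezinian of `T(u)` for the standard sequence:
`∑_ρ sgn(ρ) t_{ρ(1),1}(u) t_{ρ(2),2}(u-1) ⋯ t_{ρ(M),M}(u-M+1)` times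
`∑_σ sgn(σ) t'_{M+1,M+σ(1)}(u-M+1) ⋯ t'_{M+N,M+σ(N)}(u-M+N)`. -/
noncomputable def qsdet (M N : ℕ) : (SuperYangian (stdSeq M N))⟦X⟧ :=
  (∑ ρ : Equiv.Perm (Fin M), Equiv.Perm.sign ρ •
    (List.ofFn fun j : Fin M => shift (-((j : ℕ) : ℂ))
      (tMatrix (stdSeq M N) (Fin.castAdd N (ρ j)) (Fin.castAdd N j))).prod) *
  (∑ σ : Equiv.Perm (Fin N), Equiv.Perm.sign σ •
    (List.ofFn fun j : Fin N => shift (-(M : ℂ) + ((j : ℕ) + 1 : ℂ))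
      (tInv (stdSeq M N) (Fin.natAdd M j) (Fin.natAdd M (σ j)))).prod)

/-! ### The block Gauss decomposition -/

/-- `T(u) = F(u) D(u) E(u)` with respect to the blocks of the composition `c`: `D` is block
diagonal, `F` and `E` are block lower and upper triangular with identity diagonal blocks, and the
entries of the off-diagonal blocks of `F` and `E` have no term in `u^0`. -/
structure IsGauss {A : Type*} [Ring A] {k : ℕ} (c : Composition k)
    (T F D E : Matrix (Fin k) (Fin k) A⟦X⟧) : Prop where
  eq_mul : T = F * D * E
  F_upper : ∀ i j, c.index i < c.index j → F i j = 0
  F_diag : ∀ i j, c.index i = c.index j → F i j = if i = j then 1 else 0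
  F_lower : ∀ i j, c.index j < c.index i → constantCoeff (F i j) = 0
  D_off : ∀ i j, c.index i ≠ c.index j → D i j = 0
  E_lower : ∀ i j, c.index j < c.index i → E i j = 0
  E_diag : ∀ i j, c.index i = c.index j → E i j = if i = j then 1 else 0
  E_upper : ∀ i j, c.index i < c.index j → constantCoeff (E i j) = 0

/-- `f` and `g` have the same coefficients below `n`. -/
def Agree {B : Type*} [Ring B] (n : ℕ) (f g : B⟦X⟧) : Prop := ∀ i < n, coeff i f = coeff i g

theorem Agree.add {B : Type*} [Ring B] {n : ℕ} {f f' g g' : B⟦X⟧} (h : Agree n f f')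
    (h' : Agree n g g') : Agree n (f + g) (f' + g') := fun i hi => by
  rw [map_add, map_add, h i hi, h' i hi]

theorem Agree.mul {B : Type*} [Ring B] {n : ℕ} {f f' g g' : B⟦X⟧} (h : Agree n f f')
    (h' : Agree n g g') (hf : coeff 0 f = 0) (hf' : coeff 0 f' = 0) (hg : coeff 0 g = 0)
    (hg' : coeff 0 g' = 0) : Agree (n + 1) (f * g) (f' * g') := fun i hi => by
  rw [coeff_mul, coeff_mul]
  refine Finset.sum_congr rfl fun p hp => ?_
  have hp' := Finset.HasAntidiagonal.mem_antidiagonal.1 hp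
  rcases Nat.eq_zero_or_pos p.1 with h0 | h0
  · rw [h0, hf, hf', zero_mul, zero_mul]
  rcases Nat.eq_zero_or_pos p.2 with h1 | h1
  · rw [h1, hg, hg', mul_zero, mul_zero]
  rw [h p.1 (by omega), h' p.2 (by omega)]

/-- Coefficientwise application of a map. -/
noncomputable def mapCoeff {B : Type*} [Ring B] (p : B → B) (f : B⟦X⟧) : B⟦X⟧ :=
  PowerSeries.mk fun i => p (coeff i f)

/-- The terms of `(1 + f) (1 + d) (1 + e)` of degree at least two, where `f`, `d`, `e` are the
coefficientwise images of `x` under three maps. -/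
noncomputable def quadPart {B : Type*} [Ring B] (p q r : B → B) (x : B⟦X⟧) : B⟦X⟧ :=
  mapCoeff p x * mapCoeff q x + mapCoeff p x * mapCoeff r x + mapCoeff q x * mapCoeff r x +
    mapCoeff p x * mapCoeff q x * mapCoeff r x

theorem agree_mapCoeff {B : Type*} [Ring B] (p : B → B) {n : ℕ} {x y : B⟦X⟧} (h : Agree n x y) :
    Agree n (mapCoeff p x) (mapCoeff p y) := fun i hi => by
  rw [mapCoeff, mapCoeff, coeff_mk, coeff_mk, h i hi]

theorem coeff_zero_mapCoeff {B : Type*} [Ring B] (p : B → B) (hp : p 0 = 0) {x : B⟦X⟧}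
    (h : coeff 0 x = 0) : coeff 0 (mapCoeff p x) = 0 := by
  rw [mapCoeff, coeff_mk, h, hp]

theorem coeff_zero_mul_eq {B : Type*} [Ring B] {f : B⟦X⟧} (g : B⟦X⟧) (hf : coeff 0 f = 0) :
    coeff 0 (f * g) = 0 := by
  rw [coeff_zero_eq_constantCoeff_apply] at hf ⊢
  rw [map_mul, hf, zero_mul]

section fixedPoint

variable {B : Type*} [Ring B] (p q r : B → B)

theorem coeff_zero_quadPart (hp : p 0 = 0) (hq : q 0 = 0) {x : B⟦X⟧} (h : coeff 0 x = 0) :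
    coeff 0 (quadPart p q r x) = 0 := by
  have px := coeff_zero_mapCoeff p hp h
  have qx := coeff_zero_mapCoeff q hq h
  rw [quadPart, map_add, map_add, map_add, coeff_zero_mul_eq _ px, coeff_zero_mul_eq _ px,
    coeff_zero_mul_eq _ qx, coeff_zero_mul_eq _ (coeff_zero_mul_eq _ px), add_zero, add_zero,
    add_zero]

theorem agree_quadPart (hp : p 0 = 0) (hq : q 0 = 0) (hr : r 0 = 0) {n : ℕ} {x y : B⟦X⟧}
    (hx : coeff 0 x = 0) (hy : coeff 0 y = 0) (h : Agree n x y) :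
    Agree (n + 1) (quadPart p q r x) (quadPart p q r y) := by
  have px := coeff_zero_mapCoeff p hp hx
  have py := coeff_zero_mapCoeff p hp hy
  have qx := coeff_zero_mapCoeff q hq hx
  have qy := coeff_zero_mapCoeff q hq hy
  have rx := coeff_zero_mapCoeff r hr hx
  have ry := coeff_zero_mapCoeff r hr hy
  have ap := agree_mapCoeff p h
  have aq := agree_mapCoeff q h
  have ar := agree_mapCoeff r h
  have apq := ap.mul aq px py qx qy
  refine ((apq.add (ap.mul ar px py rx ry)).add (aq.mul ar qx qy rx ry)).add ?_
  exact Agree.mul (fun i hi => apq i (by omega)) ar (coeff_zero_mul_eq _ px)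
    (coeff_zero_mul_eq _ py) rx ry

theorem existsUnique_fixedPoint (hp : p 0 = 0) (hq : q 0 = 0) (hr : r 0 = 0) (t : B⟦X⟧)
    (ht : coeff 0 t = 0) : ∃! x : B⟦X⟧, coeff 0 x = 0 ∧ x + quadPart p q r x = t := by
  set g : B⟦X⟧ → B⟦X⟧ := fun x => t - quadPart p q r x with hg
  have g0 : ∀ x, coeff 0 x = 0 → coeff 0 (g x) = 0 := fun x hx => by
    rw [hg, map_sub, ht, coeff_zero_quadPart p q r hp hq hx, sub_zero]
  have gA : ∀ n x y, coeff 0 x = 0 → coeff 0 y = 0 → Agree n x y →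
      Agree (n + 1) (g x) (g y) := fun n x y hx hy h i hi => by
    rw [hg, map_sub, map_sub, agree_quadPart p q r hp hq hr hx hy h i hi]
  let z : ℕ → B⟦X⟧ := fun n => g^[n] 0
  have zs : ∀ n, z (n + 1) = g (z n) := fun n => Function.iterate_succ_apply' g n 0
  have z0 : ∀ n, coeff 0 (z n) = 0 := fun n => by
    induction n with
    | zero => exact map_zero _
    | succ n ih => rw [zs]; exact g0 _ ih
  have zA : ∀ n, Agree n (z n) (z (n + 1)) := by
    intro n
    induction n with
    | zero => intro i hi; omega
    | succ n ih =>
      have h := gA n (z n) (z (n + 1)) (z0 n) (z0 (n + 1)) ih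
      rw [← zs, ← zs] at h
      exact h
  have zB : ∀ n m i, i < n → coeff i (z n) = coeff i (z (n + m)) := fun n m i hi => by
    induction m with
    | zero => rfl
    | succ m ih => rw [ih]; exact zA (n + m) i (by omega)
  let w : B⟦X⟧ := PowerSeries.mk fun n => coeff n (z (n + 1))
  have w0 : coeff 0 w = 0 := by rw [coeff_mk]; exact z0 1
  have wA : ∀ n, Agree n w (z n) := fun n i hi => by
    rw [coeff_mk, zB (i + 1) (n - (i + 1)) i (by omega)]
    congr 2
    omega
  refine ⟨w, ⟨w0, ?_⟩, ?_⟩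
  · have : g w = w := by
      ext n
      rw [gA n w (z n) w0 (z0 n) (wA n) n (by omega), ← zs, wA (n + 1) n (by omega)]
    rw [← eq_sub_iff_add_eq]
    exact this.symm
  · rintro y ⟨y0, hy⟩
    have hy' : g y = y := (eq_sub_iff_add_eq.2 hy).symm
    have hw' : ∀ n, Agree n y (z n) := by
      intro n
      induction n with
      | zero => intro i hi; omega
      | succ n ih =>
        have h := gA n y (z n) y0 (z0 n) ih
        rw [hy', ← zs] at h
        exact h
    ext n
    rw [hw' (n + 1) n (by omega), wA (n + 1) n (by omega)]

end fixedPoint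

section gauss

variable {A : Type*} [Ring A] {k : ℕ} (c : Composition k)

/-- The block strictly lower triangular part of a matrix. -/
def lowPart (Q : Matrix (Fin k) (Fin k) A) : Matrix (Fin k) (Fin k) A :=
  Matrix.of fun i j => if c.index j < c.index i then Q i j else 0

/-- The block diagonal part of a matrix. -/
def diagPart (Q : Matrix (Fin k) (Fin k) A) : Matrix (Fin k) (Fin k) A :=
  Matrix.of fun i j => if c.index i = c.index j then Q i j else 0

/-- The block strictly upper triangular part of a matrix. -/
def upPart (Q : Matrix (Fin k) (Fin k) A) : Matrix (Fin k) (Fin k) A :=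
  Matrix.of fun i j => if c.index i < c.index j then Q i j else 0

theorem lowPart_zero : lowPart c (0 : Matrix (Fin k) (Fin k) A) = 0 := by
  ext i j; simp [lowPart]

theorem diagPart_zero : diagPart c (0 : Matrix (Fin k) (Fin k) A) = 0 := by
  ext i j; simp [diagPart]

theorem upPart_zero : upPart c (0 : Matrix (Fin k) (Fin k) A) = 0 := by
  ext i j; simp [upPart]

theorem parts_add (x : (Matrix (Fin k) (Fin k) A)⟦X⟧) :
    mapCoeff (lowPart c) x + mapCoeff (diagPart c) x + mapCoeff (upPart c) x = x := by
  ext n i j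
  simp only [mapCoeff, map_add, coeff_mk, Matrix.add_apply, lowPart, diagPart, upPart,
    Matrix.of_apply]
  rcases lt_trichotomy (c.index i) (c.index j) with h | h | h
  · simp [h, h.not_gt, h.ne]
  · simp [h]
  · simp [h, h.not_gt, h.ne']

theorem IsGauss.constantCoeff_F {T F D E : Matrix (Fin k) (Fin k) A⟦X⟧} (h : IsGauss c T F D E)
    (i j : Fin k) : constantCoeff (F i j) = if i = j then 1 else 0 := by
  rcases lt_trichotomy (c.index i) (c.index j) with h1 | h1 | h1
  · have : i ≠ j := fun e => by simp [e] at h1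
    rw [h.F_upper i j h1, map_zero, if_neg this]
  · rw [h.F_diag i j h1]; split_ifs <;> simp
  · have : i ≠ j := fun e => by simp [e] at h1
    rw [h.F_lower i j h1, if_neg this]

theorem IsGauss.constantCoeff_E {T F D E : Matrix (Fin k) (Fin k) A⟦X⟧} (h : IsGauss c T F D E)
    (i j : Fin k) : constantCoeff (E i j) = if i = j then 1 else 0 := by
  rcases lt_trichotomy (c.index i) (c.index j) with h1 | h1 | h1
  · have : i ≠ j := fun e => by simp [e] at h1
    rw [h.E_upper i j h1, if_neg this]
  · rw [h.E_diag i j h1]; split_ifs <;> simp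
  · have : i ≠ j := fun e => by simp [e] at h1
    rw [h.E_lower i j h1, map_zero, if_neg this]

theorem IsGauss.constantCoeff_matSeries_D {T F D E : Matrix (Fin k) (Fin k) A⟦X⟧}
    (h : IsGauss c T F D E) (hT : ∀ i j, constantCoeff (T i j) = if i = j then 1 else 0) :
    constantCoeff (matSeries D) = 1 := by
  have e := congrArg (fun P => constantCoeff (matSeries P)) h.eq_mul
  simp only [map_mul, constantCoeff_matSeries hT, constantCoeff_matSeries h.constantCoeff_F,
    constantCoeff_matSeries h.constantCoeff_E, one_mul, mul_one] at e
  exact e.symm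

theorem IsGauss.constantCoeff_D {T F D E : Matrix (Fin k) (Fin k) A⟦X⟧}
    (h : IsGauss c T F D E) (hT : ∀ i j, constantCoeff (T i j) = if i = j then 1 else 0)
    (i j : Fin k) : constantCoeff (D i j) = if i = j then 1 else 0 := by
  have e := congrFun (congrFun (h.constantCoeff_matSeries_D c hT) i) j
  rwa [← coeff_zero_eq_constantCoeff_apply, coeff_matSeries, coeff_zero_eq_constantCoeff_apply,
    Matrix.one_apply] at e

/-- The factors of a Gauss decomposition, read off from their sum. -/
theorem IsGauss.parts {T F D E : Matrix (Fin k) (Fin k) A⟦X⟧} (h : IsGauss c T F D E)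
    {x : (Matrix (Fin k) (Fin k) A)⟦X⟧}
    (hx : x = (matSeries F - 1) + (matSeries D - 1) + (matSeries E - 1)) :
    mapCoeff (lowPart c) x = matSeries F - 1 ∧ mapCoeff (diagPart c) x = matSeries D - 1 ∧
      mapCoeff (upPart c) x = matSeries E - 1 := by
  have one (n : ℕ) (i j : Fin k) : coeff n (1 : (Matrix (Fin k) (Fin k) A)⟦X⟧) i j =
      if i = j then coeff n (1 : A⟦X⟧) else 0 := by
    rw [← map_one (matSeries (A := A) (k := k)), coeff_matSeries, Matrix.one_apply]
    split_ifs <;> simp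
  refine ⟨?_, ?_, ?_⟩ <;>
  · ext n i j
    simp only [hx, mapCoeff, map_add, map_sub, coeff_mk, Matrix.add_apply, Matrix.sub_apply,
      lowPart, diagPart, upPart, Matrix.of_apply, coeff_matSeries, one]
    rcases lt_trichotomy (c.index i) (c.index j) with h1 | h1 | h1
    · have : i ≠ j := fun e => by simp [e] at h1
      simp [h1, h1.not_gt, h1.ne, this, h.F_upper i j h1, h.D_off i j h1.ne]
    · rw [h.F_diag i j h1, h.E_diag i j h1]
      by_cases hij : i = j <;> simp [h1, hij]
    · have : i ≠ j := fun e => by simp [e] at h1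
      simp [h1, h1.not_gt, h1.ne', this, h.E_lower i j h1, h.D_off i j h1.ne']

theorem existsUnique_isGauss (T : Matrix (Fin k) (Fin k) A⟦X⟧)
    (hT : ∀ i j, constantCoeff (T i j) = if i = j then 1 else 0) :
    ∃! G : Matrix (Fin k) (Fin k) A⟦X⟧ × Matrix (Fin k) (Fin k) A⟦X⟧ ×
      Matrix (Fin k) (Fin k) A⟦X⟧, IsGauss c T G.1 G.2.1 G.2.2 := by
  have ht : coeff 0 (matSeries T - 1) = 0 := by
    rw [coeff_zero_eq_constantCoeff_apply, map_sub, constantCoeff_matSeries hT, map_one, sub_self]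
  obtain ⟨x, ⟨hx0, hx⟩, hu⟩ := existsUnique_fixedPoint (lowPart c) (diagPart c) (upPart c)
    (lowPart_zero c) (diagPart_zero c) (upPart_zero c) (matSeries T - 1) ht
  set S := (matSeries (A := A) (k := k)).symm
  have entry (y : (Matrix (Fin k) (Fin k) A)⟦X⟧) (i j : Fin k) (n : ℕ) :
      coeff n (S y i j) = coeff n y i j := by
    rw [← coeff_matSeries, RingEquiv.apply_symm_apply]
  refine ⟨(1 + S (mapCoeff (lowPart c) x), 1 + S (mapCoeff (diagPart c) x),
    1 + S (mapCoeff (upPart c) x)), ?_, ?_⟩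
  · constructor
    · apply (matSeries (A := A) (k := k)).injective
      simp only [map_mul, map_add, map_one, S, RingEquiv.apply_symm_apply]
      have e : matSeries T = 1 + (mapCoeff (lowPart c) x + mapCoeff (diagPart c) x +
          mapCoeff (upPart c) x + quadPart (lowPart c) (diagPart c) (upPart c) x) := by
        rw [parts_add, hx, add_sub_cancel]
      rw [e, quadPart]
      noncomm_ring
    all_goals intro i j h
    all_goals dsimp only
    · have hij : i ≠ j := ne_of_apply_ne c.index h.ne
      ext n
      simp [Matrix.add_apply, entry, mapCoeff, lowPart, h.not_gt, hij]
    · ext n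
      simp [Matrix.add_apply, entry, mapCoeff, lowPart, h, Matrix.one_apply]
    · have hij : i ≠ j := ne_of_apply_ne c.index h.ne'
      rw [← coeff_zero_eq_constantCoeff_apply, Matrix.add_apply, Matrix.one_apply_ne hij, zero_add,
        entry, coeff_zero_mapCoeff _ (lowPart_zero c) hx0, Matrix.zero_apply]
    · have hij : i ≠ j := ne_of_apply_ne c.index h
      ext n
      simp [Matrix.add_apply, entry, mapCoeff, diagPart, h, hij]
    · have hij : i ≠ j := ne_of_apply_ne c.index h.ne'
      ext n
      simp [Matrix.add_apply, entry, mapCoeff, upPart, h.not_gt, hij]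
    · ext n
      simp [Matrix.add_apply, entry, mapCoeff, upPart, h, Matrix.one_apply]
    · have hij : i ≠ j := ne_of_apply_ne c.index h.ne
      rw [← coeff_zero_eq_constantCoeff_apply, Matrix.add_apply, Matrix.one_apply_ne hij, zero_add,
        entry, coeff_zero_mapCoeff _ (upPart_zero c) hx0, Matrix.zero_apply]
  · rintro ⟨F, D, E⟩ h
    obtain ⟨hF, hD, hE⟩ := h.parts c rfl
    have hy := hu ((matSeries F - 1) + (matSeries D - 1) + (matSeries E - 1)) ⟨?_, ?_⟩
    · rw [hy] at hF hD hE
      rw [hF, hD, hE]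
      simp [S]
    · simp only [coeff_zero_eq_constantCoeff_apply, map_add, map_sub, map_one]
      rw [h.constantCoeff_matSeries_D c hT, constantCoeff_matSeries h.constantCoeff_F,
        constantCoeff_matSeries h.constantCoeff_E]
      simp
    · rw [quadPart, hF, hD, hE]
      have e := congrArg matSeries h.eq_mul
      simp only [map_mul] at e
      rw [e]
      noncomm_ring

end gauss

/-- The block diagonal factor `D(u)` of the Gauss decomposition of `T(u)` with respect to `c`. -/
noncomputable def gaussD {k : ℕ} (s : Fin k → Fin 2) (c : Composition k) :
    Matrix (Fin k) (Fin k) (SuperYangian s)⟦X⟧ :=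
  (existsUnique_isGauss c (tMatrix s) (constantCoeff_tMatrix s)).choose.2.1

theorem exists_isGauss_gaussD {k : ℕ} (s : Fin k → Fin 2) (c : Composition k) :
    ∃ F E, IsGauss c (tMatrix s) F (gaussD s c) E :=
  ⟨_, _, (existsUnique_isGauss c (tMatrix s) (constantCoeff_tMatrix s)).choose_spec.1⟩

/-- The `a`-th diagonal block `D_a(u)` of `D(u)`. -/
noncomputable def blockD {k : ℕ} (s : Fin k → Fin 2) (c : Composition k) (a : Fin c.length) :
    Matrix (Fin (c.blocksFun a)) (Fin (c.blocksFun a)) (SuperYangian s)⟦X⟧ :=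
  (gaussD s c).submatrix (c.embedding a) (c.embedding a)

theorem isUnit_blockD {k : ℕ} (s : Fin k → Fin 2) (c : Composition k) (a : Fin c.length) :
    IsUnit (blockD s c a) := by
  obtain ⟨F, E, h⟩ := exists_isGauss_gaussD s c
  refine isUnit_of_constantCoeff fun i j => ?_
  rw [blockD, Matrix.submatrix_apply, h.constantCoeff_D c (constantCoeff_tMatrix s)]
  simp only [EmbeddingLike.apply_eq_iff_eq]

/-- The inverse `D'_a(u) = D_a(u)⁻¹` of the `a`-th diagonal block. -/
noncomputable def blockDInv {k : ℕ} (s : Fin k → Fin 2) (c : Composition k) (a : Fin c.length) :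
    Matrix (Fin (c.blocksFun a)) (Fin (c.blocksFun a)) (SuperYangian s)⟦X⟧ :=
  ((isUnit_blockD s c a).unit⁻¹ :
    (Matrix (Fin (c.blocksFun a)) (Fin (c.blocksFun a)) (SuperYangian s)⟦X⟧)ˣ)

/-- For `lam` with `m` parts and `nu` with `n` parts, the position of the `a`-th part of `lam` among
the `m + n` parts of `(lam | nu)`. -/
def evenBlock {M N : ℕ} (lam : Composition M) (nu : Composition N) (a : Fin lam.length) :
    Fin (lam.append nu).length :=
  ⟨a, by simp [Composition.append, Composition.length]; omega⟩

/-- The position of the `b`-th part of `nu` among the parts of `(lam | nu)`. -/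
def oddBlock {M N : ℕ} (lam : Composition M) (nu : Composition N) (b : Fin nu.length) :
    Fin (lam.append nu).length :=
  ⟨lam.length + b, by simp [Composition.append, Composition.length]⟩

end SuperYangian

namespace SuperYangian

/-! The even and odd factors of the Berezinian are treated separately, each by the same mechanism: a
unitriangular change of columns or rows does not alter a quantum determinant, and a block triangular
one splits into its diagonal blocks.

The noncommutative input is the Yangian relation at `v = u - 1`. It says that columns at consecutive
shifts satisfy Manin relations (`IsYang.isManin_col`): the product of two column entries,
symmetrized over the two columns, is symmetric in the row indices. So exchanging adjacent columns,
with the shifts left in place, changes the sign, and a repeated column gives zero even with a scalar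
on its right. Hence right multiples of earlier columns may be added to a column. For rows read with
increasing shifts the mirror statement allows left multiples of later rows.

Even factor. The upper left `M × M` corner satisfies the ordinary Yangian relations and factors as
`(FD)E`. The columns of `FD`, obtained on multiplying by `E⁻¹`, are columns of the corner plus right
multiples of earlier ones. As `FD` is block lower triangular with diagonal blocks `D_a`, the
determinant becomes a product of `qdet D_a`, each shifted by the position at which its block starts.

Odd factor. Signs collapse in the odd corner of `T⁻¹`, which again satisfies the Yangian relations
(`IsSuperYang.isYang_inv`). The factor is its row determinant. Here `E T⁻¹ = (FD)⁻¹` is block lower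
triangular with diagonal blocks `D'_a`, and its odd rows are those of `T⁻¹` plus left multiples of
later ones. This gives a product of row determinants of the `D'_a`. Each `D'_a` is a corner of the
inverse of a truncation of `T`, so it is a Yangian matrix too, and for such matrices the row and
column determinants agree (`IsYang.qdet_eq_rowDet`). That agreement follows by induction on the
size: both forms split off the same Schur complement, on opposite sides, and its inverse, an entry
of the inverse matrix, commutes with the smaller determinant. -/

theorem take_ofFn_congr {α : Type*} {n : ℕ} {g g' : Fin n → α} {p : ℕ}
    (h : ∀ q : Fin n, (q : ℕ) < p → g q = g' q) :
    (List.ofFn g).take p = (List.ofFn g').take p := by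
  refine List.ext_getElem (by simp) fun i h1 h2 => ?_
  simp only [List.getElem_take, List.getElem_ofFn]
  simp only [List.length_take, List.length_ofFn] at h1
  exact h _ (by simp; omega)

theorem drop_ofFn_congr {α : Type*} {n : ℕ} {g g' : Fin n → α} {p : ℕ}
    (h : ∀ q : Fin n, p ≤ (q : ℕ) → g q = g' q) :
    (List.ofFn g).drop p = (List.ofFn g').drop p := by
  refine List.ext_getElem (by simp) fun i h1 h2 => ?_
  simp only [List.getElem_drop, List.getElem_ofFn]
  exact h _ (by simp)

/-! ### Noncommutative determinants of sequences of vectors, and Manin relations. -/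

section ndet

variable {R : Type*} [Ring R] {n : ℕ}

/-- The determinant `∑_σ sgn(σ) W_1(σ(1)) ⋯ W_n(σ(n))` of a sequence `W_1, …, W_n` of vectors with
entries in a noncommutative ring. -/
def ndet (W : Fin n → Fin n → R) : R :=
  ∑ σ : Equiv.Perm (Fin n), Equiv.Perm.sign σ • (List.ofFn fun p => W p (σ p)).prod

theorem prod_ofFn_eq_take_mul_drop (g : Fin n → R) {p : ℕ} (hp : p < n) :
    (List.ofFn g).prod =
      ((List.ofFn g).take p).prod * g ⟨p, hp⟩ * ((List.ofFn g).drop (p + 1)).prod := by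
  rw [← List.prod_take_mul_prod_drop (List.ofFn g) p,
    List.drop_eq_getElem_cons (by simpa using hp), List.prod_cons, List.getElem_ofFn, mul_assoc]

theorem prod_ofFn_eq_take_mul_mul_drop (g : Fin n → R) {p : ℕ} (hp : p + 1 < n) :
    (List.ofFn g).prod = ((List.ofFn g).take p).prod *
      (g ⟨p, by omega⟩ * g ⟨p + 1, hp⟩) * ((List.ofFn g).drop (p + 2)).prod := by
  rw [prod_ofFn_eq_take_mul_drop g (p := p) (by omega), List.drop_eq_getElem_cons (by simpa using hp),
    List.prod_cons, List.getElem_ofFn]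
  simp only [mul_assoc]

/-- An alternating sum vanishes if the factor at two adjacent positions is symmetric. -/
theorem sum_sign_smul_eq_zero_of_symm (W : Fin n → Fin n → R) {p : ℕ} (hp : p + 1 < n)
    (h : Fin n → Fin n → R) (hs : ∀ i k, h i k = h k i) :
    ∑ σ : Equiv.Perm (Fin n), Equiv.Perm.sign σ •
      (((List.ofFn fun q => W q (σ q)).take p).prod *
        h (σ ⟨p, by omega⟩) (σ ⟨p + 1, hp⟩) *
        ((List.ofFn fun q => W q (σ q)).drop (p + 2)).prod) = 0 := by
  have hne : (⟨p, by omega⟩ : Fin n) ≠ ⟨p + 1, hp⟩ := by simp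
  refine Finset.sum_involution
    (fun σ _ => σ * Equiv.swap ⟨p, by omega⟩ ⟨p + 1, hp⟩) ?_ ?_ ?_ ?_
  · intro σ _
    have e : ∀ q : Fin n, (q : ℕ) ≠ p → (q : ℕ) ≠ p + 1 →
        Equiv.swap (⟨p, by omega⟩ : Fin n) ⟨p + 1, hp⟩ q = q := fun q h1 h2 =>
      Equiv.swap_apply_of_ne_of_ne (by simpa [Fin.ext_iff] using h1)
        (by simpa [Fin.ext_iff] using h2)
    have e1 := take_ofFn_congr
      (g := fun q => W q ((σ * Equiv.swap (⟨p, by omega⟩ : Fin n) ⟨p + 1, hp⟩) q))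
      (g' := fun q => W q (σ q)) (p := p)
      (fun q hq => by rw [Equiv.Perm.mul_apply, e q (by omega) (by omega)])
    have e2 := drop_ofFn_congr
      (g := fun q => W q ((σ * Equiv.swap (⟨p, by omega⟩ : Fin n) ⟨p + 1, hp⟩) q))
      (g' := fun q => W q (σ q)) (p := p + 2)
      (fun q hq => by rw [Equiv.Perm.mul_apply, e q (by omega) (by omega)])
    rw [e1, e2, Equiv.Perm.mul_apply, Equiv.Perm.mul_apply, Equiv.swap_apply_left, Equiv.swap_apply_right,
      hs (σ ⟨p + 1, hp⟩), Equiv.Perm.sign_mul, Equiv.Perm.sign_swap hne]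
    simp
  · intro σ _ _ h1
    have h2 := congrArg (fun τ : Equiv.Perm (Fin n) => τ ⟨p, by omega⟩) h1
    simp at h2
  · intro σ _
    exact Finset.mem_univ _
  · intro σ _
    rw [mul_assoc, Equiv.swap_mul_self, mul_one]

theorem ndet_eq_zero_of_symm (W : Fin n → Fin n → R) {p : ℕ} (hp : p + 1 < n)
    (hs : ∀ i k, W ⟨p, by omega⟩ i * W ⟨p + 1, hp⟩ k = W ⟨p, by omega⟩ k * W ⟨p + 1, hp⟩ i) :
    ndet W = 0 := by
  rw [← sum_sign_smul_eq_zero_of_symm W hp _ hs]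
  exact Finset.sum_congr rfl fun σ _ => by rw [prod_ofFn_eq_take_mul_mul_drop _ hp]

/-- Used with `W'` carrying the vectors of `W` at `p` and `p + 1` in exchanged order. Neither
product need be symmetric alone; symmetry of the sum is what yields the change of sign. -/
theorem ndet_add_ndet_eq_zero (W W' : Fin n → Fin n → R) {p : ℕ} (hp : p + 1 < n)
    (hW : ∀ q : Fin n, (q : ℕ) ≠ p → (q : ℕ) ≠ p + 1 → W q = W' q)
    (hs : ∀ i k, W ⟨p, by omega⟩ i * W ⟨p + 1, hp⟩ k + W' ⟨p, by omega⟩ i * W' ⟨p + 1, hp⟩ k =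
      W ⟨p, by omega⟩ k * W ⟨p + 1, hp⟩ i + W' ⟨p, by omega⟩ k * W' ⟨p + 1, hp⟩ i) :
    ndet W + ndet W' = 0 := by
  rw [← sum_sign_smul_eq_zero_of_symm W hp _ hs, ndet, ndet, ← Finset.sum_add_distrib]
  refine Finset.sum_congr rfl fun σ _ => ?_
  rw [prod_ofFn_eq_take_mul_mul_drop (fun q => W q (σ q)) hp,
    prod_ofFn_eq_take_mul_mul_drop (fun q => W' q (σ q)) hp,
    take_ofFn_congr (g := fun q => W' q (σ q)) (g' := fun q => W q (σ q)) (p := p)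
      (fun q hq => by rw [hW q (by omega) (by omega)]),
    drop_ofFn_congr (g := fun q => W' q (σ q)) (g' := fun q => W q (σ q)) (p := p + 2)
      (fun q hq => by rw [hW q (by omega) (by omega)]), ← smul_add]
  noncomm_ring

/-- Additivity in one vector, packaged as a homomorphism so that sums can be pulled out with
`map_add` and `map_sum`. -/
theorem exists_ndet_update_eq (W : Fin n → Fin n → R) (p : Fin n) :
    ∃ φ : (Fin n → R) →+ R, ∀ w, ndet (Function.update W p w) = φ w := by
  refine ⟨∑ σ : Equiv.Perm (Fin n), Equiv.Perm.sign σ •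
    ((AddMonoidHom.mulRight ((List.ofFn fun q => W q (σ q)).drop (p + 1)).prod).comp
      ((AddMonoidHom.mulLeft ((List.ofFn fun q => W q (σ q)).take p).prod).comp
        (Pi.evalAddMonoidHom _ (σ p)))), fun w => ?_⟩
  rw [ndet, AddMonoidHom.finsetSum_apply]
  refine Finset.sum_congr rfl fun σ _ => ?_
  rw [prod_ofFn_eq_take_mul_drop _ p.2,
    take_ofFn_congr (g := fun q => Function.update W p w q (σ q)) (g' := fun q => W q (σ q))
      (fun q hq => by rw [Function.update_of_ne (by simpa [Fin.ext_iff] using hq.ne)]),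
    drop_ofFn_congr (g := fun q => Function.update W p w q (σ q)) (g' := fun q => W q (σ q))
      (fun q hq => by rw [Function.update_of_ne (by simp [Fin.ext_iff]; omega)])]
  simp

/-- `v p a i` is the `i`-th entry of the vector `v_a` at position `p`: the commutation relations
between the entries of the columns of a Manin matrix, twisted by the position. -/
structure IsManin {κ : Type*} (v : ℕ → κ → Fin n → R) : Prop where
  symm : ∀ p, p + 1 < n → ∀ a b i k, v p a i * v (p + 1) b k + v p b i * v (p + 1) a k =
    v p a k * v (p + 1) b i + v p b k * v (p + 1) a i
  self : ∀ p, p + 1 < n → ∀ a i k, v p a i * v (p + 1) a k = v p a k * v (p + 1) a i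

variable {κ : Type*} {v : ℕ → κ → Fin n → R}

/-- The vector at position `m` is moved left by adjacent exchanges, each costing a sign, until it
stands next to its copy, where `IsManin.self` applies. The factor `x` is harmless because it stays
to the right of both vectors being exchanged. Nothing is asked of the positions after `m`, so the
induction is free to leave arbitrary vectors there. -/
theorem IsManin.ndet_eq_zero_of_repeat (hv : IsManin v) (m : ℕ) : ∀ (W : Fin n → Fin n → R)
    (hm : m < n) (i : ℕ), i < m → ∀ (f : ℕ → κ) (x : R),
      (∀ q : Fin n, (q : ℕ) < m → W q = v q (f q)) →
      (∀ t, W ⟨m, hm⟩ t = v m (f i) t * x) → ndet W = 0 := by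
  induction m with
  | zero => intro W hm i hi; omega
  | succ m ih =>
    intro W hm i hi f x hW hx
    have hWm : W ⟨m, by omega⟩ = v m (f m) := hW ⟨m, by omega⟩ (by simp)
    by_cases him : i = m
    · subst him
      refine ndet_eq_zero_of_symm W hm fun j k => ?_
      rw [hWm, hx, hx, ← mul_assoc, ← mul_assoc, hv.self i hm]
    · have hne : (⟨m, by omega⟩ : Fin n) ≠ ⟨m + 1, hm⟩ := by simp
      set W' : Fin n → Fin n → R := Function.update (Function.update W ⟨m, by omega⟩ (v m (f i)))
        ⟨m + 1, hm⟩ (fun t => v (m + 1) (f m) t * x) with hW'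
      have h1 : ndet W + ndet W' = 0 := by
        refine ndet_add_ndet_eq_zero W W' hm (fun q h1 h2 => ?_) fun j k => ?_
        · rw [hW', Function.update_of_ne (by simpa [Fin.ext_iff] using h2),
            Function.update_of_ne (by simpa [Fin.ext_iff] using h1)]
        · rw [hW', Function.update_self, Function.update_of_ne hne, Function.update_self, hWm, hx,
            hx]
          simp only [← mul_assoc, ← add_mul]
          rw [hv.symm m hm]
      have h2 : ndet W' = 0 := by
        refine ih W' (by omega) i (by omega) f 1 (fun q hq => ?_) fun t => ?_
        · rw [hW', Function.update_of_ne (by simp [Fin.ext_iff]; omega),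
            Function.update_of_ne (by simp [Fin.ext_iff]; omega), hW q (by omega)]
        · rw [hW', Function.update_of_ne hne, Function.update_self, mul_one]
      rwa [h2, add_zero] at h1

/-- Adding right multiples of earlier vectors does not change the determinant. -/
theorem IsManin.ndet_eq_of_add_earlier {v : ℕ → Fin n → Fin n → R} (hv : IsManin v)
    {P : Fin n → Fin n → R} (e : Fin n → Fin n → R) (he : ∀ q j, q ≤ j → e q j = 0)
    (hP : ∀ q i, P q i = v q q i + ∑ j, v q j i * e q j) :
    ndet P = ndet fun q => v q q := by
  -- The vectors of `P` are replaced from left to right: when position `m` is treated, all earlier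
  -- positions already carry unmodified vectors, as the vanishing lemma requires.
  let H : ℕ → Fin n → Fin n → R := fun m q => if (q : ℕ) < m then v q q else P q
  have step : ∀ m, m < n → ndet (H m) = ndet (H (m + 1)) := by
    intro m hm
    obtain ⟨φ, hφ⟩ := exists_ndet_update_eq (H m) ⟨m, hm⟩
    have h1 : H m = Function.update (H m) ⟨m, hm⟩
        (v m ⟨m, hm⟩ + ∑ j, fun i => v m j i * e ⟨m, hm⟩ j) := by
      refine (Function.update_eq_self_iff.2 ?_).symm
      ext i
      simp only [Pi.add_apply, Finset.sum_apply]
      simp [H, hP]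
    have h2 : H (m + 1) = Function.update (H m) ⟨m, hm⟩ (v m ⟨m, hm⟩) := by
      ext q i
      by_cases hq : q = ⟨m, hm⟩
      · subst hq; simp [H]
      · have : (q : ℕ) ≠ m := by simpa [Fin.ext_iff] using hq
        rw [Function.update_of_ne hq]
        have h5 : (q : ℕ) < m + 1 ↔ (q : ℕ) < m := by omega
        simp only [H, h5]
    have h3 : ∀ j, φ (fun i => v m j i * e ⟨m, hm⟩ j) = 0 := by
      intro j
      by_cases hj : (⟨m, hm⟩ : Fin n) ≤ j
      · rw [he _ _ hj]
        simp only [mul_zero]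
        exact map_zero φ
      · have hjm : (j : ℕ) < m := by simpa [Fin.le_def] using hj
        rw [← hφ]
        refine hv.ndet_eq_zero_of_repeat m _ hm j hjm
          (fun q => if h : q < n then ⟨q, h⟩ else j) (e ⟨m, hm⟩ j) (fun q hq => ?_) fun t => ?_
        · rw [Function.update_of_ne (by simp [Fin.ext_iff]; omega)]
          simp [H, hq]
        · simp
    rw [h2, hφ]
    conv_lhs => rw [h1, hφ, map_add, map_sum]
    rw [Finset.sum_eq_zero fun j _ => h3 j, add_zero]
  have all : ∀ m, m ≤ n → ndet (H 0) = ndet (H m) := by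
    intro m
    induction m with
    | zero => intro _; rfl
    | succ m ih => intro hm; rw [ih (by omega), step m (by omega)]
  have h0 : H 0 = P := by ext q i; simp [H]
  have hn : H n = fun q : Fin n => v q q := by ext q i; simp [H]
  rw [← h0, all n le_rfl, hn]

/-- Passing to the opposite ring reverses each product; reversing the positions undoes this at the
cost of one global sign. -/
theorem ndet_op (W : Fin n → Fin n → R) :
    ndet (fun p i => MulOpposite.op (W p.rev i)) =
      MulOpposite.op (Equiv.Perm.sign (Fin.revPerm (n := n)) • ndet W) := by
  rw [ndet, ndet, Finset.smul_sum, Finset.op_sum, ← Equiv.sum_comp (Equiv.mulRight Fin.revPerm)]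
  refine Finset.sum_congr rfl fun σ _ => ?_
  rw [Equiv.coe_mulRight, Equiv.Perm.sign_mul, mul_comm, mul_smul, MulOpposite.op_smul, MulOpposite.op_smul,
    MulOpposite.op_list_prod]
  congr 3
  refine List.ext_getElem (by simp) fun i h1 h2 => ?_
  have e : n - (i + 1) = n - 1 - i := by omega
  simp [Fin.rev, e]

/-- Adding left multiples of later vectors does not change the determinant. -/
theorem IsManin.ndet_eq_of_add_later {v : ℕ → Fin n → Fin n → R} (hv : IsManin v)
    {P : Fin n → Fin n → R} (e : Fin n → Fin n → R) (he : ∀ q j, j ≤ q → e q j = 0)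
    (hP : ∀ q i, P q i = v q q i + ∑ j, e q j * v q j i) :
    ndet P = ndet fun q => v q q := by
  -- In the opposite ring, with positions and labels reversed, left multiples of later vectors
  -- become right multiples of earlier ones. The subtraction `n - 1 - p` is reversal for `p < n`.
  have hv' : IsManin (R := Rᵐᵒᵖ) fun p (a : Fin n) i => MulOpposite.op (v (n - 1 - p) a.rev i) := by
    refine ⟨fun p hp a b i k => ?_, fun p hp a i k => ?_⟩
    all_goals
      have e1 : n - 1 - p = n - 1 - (p + 1) + 1 := by omega
      rw [e1]
      simp only [← MulOpposite.op_mul, ← MulOpposite.op_add]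
    · rw [add_comm, hv.symm _ (by omega), add_comm]
    · rw [hv.self _ (by omega)]
  have rv : ∀ q : Fin n, n - 1 - (q : ℕ) = (q.rev : ℕ) := fun q => by
    rw [Fin.val_rev]; omega
  have h := hv'.ndet_eq_of_add_earlier (P := fun p i => MulOpposite.op (P p.rev i))
    (fun q j => MulOpposite.op (e q.rev j.rev))
    (fun q j h => by rw [he _ _ (Fin.rev_le_rev.2 h), MulOpposite.op_zero]) (fun q i => by
      rw [hP, MulOpposite.op_add, Finset.op_sum, ← Equiv.sum_comp Fin.revPerm]
      simp [rv])
  simp only [rv] at h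
  rw [ndet_op, ndet_op (fun q => v q q)] at h
  exact (MulAction.injective _) (MulOpposite.op_injective h)

theorem ndet_comp_perm (W : Fin n → Fin n → R) (τ : Equiv.Perm (Fin n)) :
    ndet (fun p i => W p (τ i)) = Equiv.Perm.sign τ • ndet W := by
  rw [ndet, ndet, Finset.smul_sum, ← Equiv.sum_comp (Equiv.mulLeft τ⁻¹)]
  refine Finset.sum_congr rfl fun σ _ => ?_
  simp [smul_smul]

/-- Adjacent transpositions generate the symmetric group, and each one changes the sign by the Manin
relation. Only the vectors move; the shifts belong to the positions. -/
theorem IsManin.ndet_perm {v : ℕ → Fin n → Fin n → R} (hv : IsManin v) (τ : Equiv.Perm (Fin n)) :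
    ndet (fun p => v p (τ p)) = Equiv.Perm.sign τ • ndet fun p => v p p := by
  cases n with
  | zero => simp [Subsingleton.elim τ 1]
  | succ n =>
    have hτ : τ ∈ Submonoid.closure
        (Set.range fun i : Fin n => Equiv.swap i.castSucc i.succ) := by
      rw [Equiv.Perm.mclosure_swap_castSucc_succ]; trivial
    induction hτ using Submonoid.closure_induction_right with
    | one => simp
    | mul_right τ _ s hs ih =>
      obtain ⟨i, rfl⟩ := hs
      have h := ndet_add_ndet_eq_zero (fun p => v p ((τ * Equiv.swap i.castSucc i.succ) p))
        (fun p => v p (τ p)) (p := i) (by omega) (fun q h1 h2 => by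
          rw [Equiv.Perm.mul_apply, Equiv.swap_apply_of_ne_of_ne]
          · simpa [Fin.ext_iff] using h1
          · simpa [Fin.ext_iff] using h2) (fun j k => by
          have e1 : (⟨i, by omega⟩ : Fin (n + 1)) = i.castSucc := rfl
          have e2 : (⟨i + 1, by omega⟩ : Fin (n + 1)) = i.succ := rfl
          simp only [e1, e2, Equiv.Perm.mul_apply, Equiv.swap_apply_left, Equiv.swap_apply_right]
          exact hv.symm i (by omega) _ _ _ _)
      rw [eq_neg_of_add_eq_zero_left h, ih, Equiv.Perm.sign_mul,
        Equiv.Perm.sign_swap (by simp [Fin.ext_iff])]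
      simp

theorem ndet_zero (W : Fin 0 → Fin 0 → R) : ndet W = 1 := by
  rw [ndet, Fintype.sum_unique]
  simp

theorem ndet_one (W : Fin 1 → Fin 1 → R) : ndet W = W 0 0 := by
  simp [ndet]

/-- Only permutations preserving the first `k` indices contribute. These are the pairs in `S_k ×
S_l`, and the first `k` factors precede the others, so the sum factors without any commutation. -/
theorem ndet_add_of_mapsTo {k l : ℕ} (W : Fin (k + l) → Fin (k + l) → R)
    (hW : ∀ σ : Equiv.Perm (Fin (k + l)), (∀ p, W p (σ p) ≠ 0) →
      ∀ p : Fin (k + l), (p : ℕ) < k → (σ p : ℕ) < k) :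
    ndet W = ndet (fun p i => W (Fin.castAdd l p) (Fin.castAdd l i)) *
      ndet fun p i => W (Fin.natAdd k p) (Fin.natAdd k i) := by
  rw [ndet, ndet, ndet, Finset.sum_mul_sum, ← Finset.sum_product']
  symm
  refine Finset.sum_of_injOn
    (fun σ => finSumFinEquiv.permCongr (Equiv.Perm.sumCongr σ.1 σ.2)) ?_ ?_ ?_ ?_
  · intro σ _ τ _ h
    have h := Equiv.Perm.sumCongrHom_injective (finSumFinEquiv.permCongr.injective h)
    exact h
  · intro σ _; simp
  · intro σ _ hσ
    by_contra h0
    have hne : ∀ p, W p (σ p) ≠ 0 := by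
      intro p hp
      refine h0 ?_
      rw [List.prod_eq_zero, smul_zero]
      exact (List.mem_ofFn' _ _).2 ⟨p, hp⟩
    have hm := hW σ hne
    obtain ⟨τ, hτ⟩ := Equiv.Perm.mem_sumCongrHom_range_of_perm_mapsTo_inl
      (σ := (finSumFinEquiv (m := k) (n := l)).permCongr.symm σ) (by
        rintro _ ⟨a, rfl⟩
        have := hm (Fin.castAdd l a) (by simp)
        refine ⟨⟨_, this⟩, ?_⟩
        rw [← finSumFinEquiv.apply_eq_iff_eq]
        ext
        simp)
    refine hσ ⟨τ, by simp, ?_⟩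
    change finSumFinEquiv.permCongr (Equiv.Perm.sumCongrHom _ _ τ) = σ
    rw [hτ, Equiv.apply_symm_apply]
  · rintro ⟨σ, τ⟩ _
    rw [Equiv.Perm.sign_permCongr, Equiv.Perm.sign_sumCongr, List.ofFn_add, List.prod_append,
      smul_mul_smul_comm]
    have e1 : ∀ i : Fin k, Fin.castLE (Nat.le_add_right k l) i = Fin.castAdd l i := fun _ => rfl
    simp [e1]

/-- The determinant of a block triangular sequence of vectors. -/
theorem ndet_add {k l : ℕ} (W : Fin (k + l) → Fin (k + l) → R)
    (hW : (∀ p i : Fin (k + l), (p : ℕ) < k → k ≤ (i : ℕ) → W p i = 0) ∨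
      ∀ p i : Fin (k + l), k ≤ (p : ℕ) → (i : ℕ) < k → W p i = 0) :
    ndet W = ndet (fun p i => W (Fin.castAdd l p) (Fin.castAdd l i)) *
      ndet fun p i => W (Fin.natAdd k p) (Fin.natAdd k i) := by
  refine ndet_add_of_mapsTo W fun σ hσ p hp => ?_
  rcases hW with h | h
  · by_contra hk
    exact hσ p (h _ _ hp (by omega))
  · by_contra hk
    -- Here the vanishing pattern only says that `σ` maps the last `l` indices into themselves; by
    -- finiteness it maps onto them, so no earlier index can land there.
    let S : Finset (Fin (k + l)) := Finset.univ.filter fun q => k ≤ (q : ℕ)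
    have hS : Set.MapsTo σ S S := by
      intro q hq
      simp only [S, Finset.coe_filter, Finset.mem_univ, true_and, Set.mem_ofPred_eq] at hq ⊢
      by_contra hq'
      exact hσ q (h _ _ hq (by omega))
    have hs := Finset.surjOn_of_injOn_of_card_le σ hS σ.injective.injOn le_rfl
    obtain ⟨q, hq, hqp⟩ := hs (show σ p ∈ (S : Set _) by simp [S]; omega)
    rw [σ.injective hqp] at hq
    simp [S] at hq
    omega

/-- The determinant of the diagonal block of size `l` that begins at position `a`. -/
def ndetAt (W : ℕ → ℕ → R) (a l : ℕ) : R :=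
  ndet fun p i : Fin l => W (a + p) (a + i)

/-- Indexing `W` by natural numbers lets blocks be cut at the `s r` without casts. Each inductive
step splits off the last block. -/
theorem ndetAt_eq_prod (W : ℕ → ℕ → R) (s : ℕ → ℕ) (hs : Monotone s) (hs0 : s 0 = 0)
    (hW : (∀ r p i, p < s r → s r ≤ i → W p i = 0) ∨
      ∀ r p i, s r ≤ p → i < s r → W p i = 0) (m : ℕ) :
    ndetAt W 0 (s m) = (List.ofFn fun a : Fin m => ndetAt W (s a) (s (a + 1) - s a)).prod := by
  induction m with
  | zero => rw [hs0, List.ofFn_zero, List.prod_nil, ndetAt, ndet_zero]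
  | succ m ih =>
    rw [List.ofFn_succ', List.concat_eq_append, List.prod_append]
    simp only [Fin.val_castSucc, Fin.val_last, List.prod_singleton]
    rw [← ih]
    obtain ⟨l, hl⟩ := Nat.exists_eq_add_of_le (hs (Nat.le_succ m))
    rw [Nat.succ_eq_add_one] at hl
    rw [hl, Nat.add_sub_cancel_left, ndetAt, ndet_add, ndetAt, ndetAt]
    · simp
    · rcases hW with h | h
      · left
        intro p i hp hi
        exact h m _ _ (by omega) (by omega)
      · right
        intro p i hp hi
        exact h m _ _ (by omega) (by omega)

end ndet

/-! ### The substitution `u ↦ u + a` as a ring homomorphism. -/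

section shift

/-- The expansion of `(u + a)⁻¹` in powers of `u⁻¹`. -/
noncomputable def invShift (a : ℂ) : ℂ⟦X⟧ := X * PowerSeries.mk fun m => (-a) ^ m

theorem invShift_eq (a : ℂ) : invShift a * (1 + C a * X) = X := by
  have h : (PowerSeries.mk fun m => (-a) ^ m) * (1 + C a * X) = (1 : ℂ⟦X⟧) := by
    ext n
    rw [mul_add, mul_one, mul_left_comm, map_add, coeff_C_mul]
    cases n with
    | zero => simp
    | succ n => rw [coeff_succ_mul_X, coeff_mk, coeff_mk, coeff_one, if_neg (by simp)]; ring
  rw [invShift, mul_assoc, h, mul_one]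

theorem coeff_invShift_pow_of_lt (a : ℂ) {n r : ℕ} (h : n < r) :
    coeff n (invShift a ^ r) = 0 := by
  rw [invShift, mul_pow, coeff_X_pow_mul', if_neg (by omega)]

variable {A : Type*} [Ring A] [Algebra ℂ A]

/-- Since `(u + a)^{-r}` starts in degree `r`, the range may be enlarged; a common range for all
coefficients makes it possible to interchange sums. -/
theorem coeff_shift (a : ℂ) (f : A⟦X⟧) {n m : ℕ} (h : n ≤ m) :
    coeff n (shift a f) = ∑ r ∈ Finset.range (m + 1), coeff n (invShift a ^ r) • coeff r f := by
  rw [shift, coeff_mk]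
  refine Finset.sum_subset (Finset.range_mono (by omega)) fun r _ hr => ?_
  rw [← invShift, coeff_invShift_pow_of_lt a (by simpa using hr), zero_smul]

theorem shift_add (a : ℂ) (f g : A⟦X⟧) : shift a (f + g) = shift a f + shift a g := by
  ext n
  simp [shift, Finset.sum_add_distrib]

theorem shift_smul (a c : ℂ) (f : A⟦X⟧) : shift a (c • f) = c • shift a f := by
  ext n
  simp [shift, Finset.smul_sum, smul_comm c]

theorem shift_C (a : ℂ) (x : A) : shift a (C x) = C x := by
  ext n
  rw [coeff_shift a _ le_rfl, Finset.sum_eq_single 0]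
  · simp [coeff_one, coeff_C]
  · intro r _ hr
    rw [coeff_C, if_neg hr, smul_zero]
  · simp

theorem shift_mul (a : ℂ) (f g : A⟦X⟧) : shift a (f * g) = shift a f * shift a g := by
  ext n
  have e1 : coeff n (shift a f * shift a g) = ∑ r ∈ Finset.range (n + 1),
      ∑ s ∈ Finset.range (n + 1), coeff n (invShift a ^ (r + s)) • (coeff r f * coeff s g) := by
    have : ∀ p ∈ Finset.HasAntidiagonal.antidiagonal n, coeff p.1 (shift a f) * coeff p.2 (shift a g) =
        ∑ r ∈ Finset.range (n + 1), ∑ s ∈ Finset.range (n + 1),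
          (coeff p.1 (invShift a ^ r) * coeff p.2 (invShift a ^ s)) •
            (coeff r f * coeff s g) := by
      intro p hp
      have hp := Finset.HasAntidiagonal.mem_antidiagonal.1 hp
      rw [coeff_shift a f (m := n) (by omega), coeff_shift a g (m := n) (by omega),
        Finset.sum_mul_sum]
      simp only [smul_mul_smul_comm]
    rw [coeff_mul, Finset.sum_congr rfl this, Finset.sum_comm]
    refine Finset.sum_congr rfl fun r _ => ?_
    rw [Finset.sum_comm]
    refine Finset.sum_congr rfl fun s _ => ?_
    rw [← Finset.sum_smul, pow_add, coeff_mul]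
  rw [e1, coeff_shift a _ le_rfl, ← Finset.sum_product']
  simp only [coeff_mul, Finset.smul_sum]
  -- The two sums differ only by the pairs with `r + s > n`, for which the coefficient of `(u +
  -- a)^{-(r+s)}` in degree `n` is zero.
  rw [Finset.sum_sigma']
  refine Finset.sum_of_injOn (fun x => x.2) ?_ ?_ ?_ ?_
  · rintro ⟨r, p⟩ hp ⟨s, q⟩ hq h
    simp only [Finset.coe_sigma, Set.mem_sigma_iff, Finset.mem_coe,
      Finset.HasAntidiagonal.mem_antidiagonal] at hp hq h
    subst h
    obtain ⟨_, rfl⟩ := hp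
    obtain ⟨_, rfl⟩ := hq
    rfl
  · rintro ⟨r, p⟩ hp
    simp only [Finset.coe_sigma, Set.mem_sigma_iff, Finset.mem_coe,
      Finset.HasAntidiagonal.mem_antidiagonal,
      Finset.mem_range, Finset.mem_product] at hp ⊢
    omega
  · rintro ⟨r, s⟩ _ h
    rw [coeff_invShift_pow_of_lt, zero_smul]
    by_contra hn
    refine h ⟨⟨r + s, (r, s)⟩, ?_, rfl⟩
    simp
    omega
  · rintro ⟨r, p⟩ hp
    simp only [Finset.mem_sigma, Finset.HasAntidiagonal.mem_antidiagonal] at hp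
    rw [hp.2]

/-- `f(u) ↦ f(u + a)` as a ring homomorphism. -/
noncomputable def shiftHom (a : ℂ) : A⟦X⟧ →+* A⟦X⟧ where
  toFun := shift a
  map_one' := by rw [← map_one (C (R := A)), shift_C]
  map_mul' := shift_mul a
  map_zero' := by rw [← map_zero (C (R := A)), shift_C]
  map_add' := shift_add a

theorem shiftHom_apply (a : ℂ) (f : A⟦X⟧) : shiftHom a f = shift a f := rfl

theorem shiftHom_smul (a c : ℂ) (f : A⟦X⟧) : shiftHom a (c • f) = c • shiftHom a f :=
  shift_smul a c f

theorem shift_X (a : ℂ) : shift a (X : ℂ⟦X⟧) = invShift a := by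
  ext n
  rw [coeff_shift a _ (Nat.le_succ n), Finset.sum_eq_single 1]
  · simp
  · intro r _ hr
    rw [coeff_X, if_neg hr, smul_zero]
  · simp

theorem isUnit_one_add_mul_invShift (a b : ℂ) : IsUnit (1 + C b * invShift a) := by
  rw [PowerSeries.isUnit_iff_constantCoeff]
  simp [invShift]

/-- Both sides solve `w (1 + b (u + a)⁻¹) = (u + a)⁻¹`, and the second factor is a unit. -/
theorem shift_invShift (a b : ℂ) : shift a (invShift b) = invShift (a + b) := by
  have h1 := congrArg (shiftHom a) (invShift_eq b)
  simp only [map_mul, map_add, map_one, shiftHom_apply, shift_X, shift_C] at h1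
  refine (isUnit_one_add_mul_invShift a b).mul_right_cancel (h1.trans ?_)
  have u : IsUnit (1 + C a * X : ℂ⟦X⟧) := by
    rw [PowerSeries.isUnit_iff_constantCoeff]
    simp
  refine u.mul_right_cancel ?_
  have e2 := invShift_eq (a + b)
  have e1 := invShift_eq a
  rw [map_add] at e2
  linear_combination e1 - e2 - C b * invShift (a + b) * e1

theorem shift_shift (a b : ℂ) (f : A⟦X⟧) : shift a (shift b f) = shift (a + b) f := by
  ext n
  have e : ∀ s, coeff n (invShift (a + b) ^ s) = ∑ r ∈ Finset.range (n + 1),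
      coeff n (invShift a ^ r) • coeff r (invShift b ^ s) := by
    intro s
    rw [← coeff_shift a _ le_rfl, ← shift_invShift, ← shiftHom_apply, ← map_pow]
    rfl
  rw [coeff_shift a _ le_rfl, coeff_shift (a + b) _ le_rfl]
  simp only [e, Finset.sum_smul]
  rw [Finset.sum_comm]
  refine Finset.sum_congr rfl fun r hr => ?_
  rw [coeff_shift b f (m := n) (by simpa [Nat.lt_succ_iff] using hr), Finset.smul_sum]
  simp only [smul_assoc]

theorem shiftHom_shiftHom (a b : ℂ) (f : A⟦X⟧) :
    shiftHom a (shiftHom b f) = shiftHom (a + b) f := shift_shift a b f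

theorem shiftHom_zero (f : A⟦X⟧) : shiftHom 0 f = f := by
  ext n
  rw [shiftHom_apply, coeff_shift 0 _ le_rfl, Finset.sum_eq_single n]
  · have : invShift 0 = X := by simpa using invShift_eq 0
    rw [this]; simp
  · intro r _ hr
    have : invShift 0 = X := by simpa using invShift_eq 0
    rw [this, coeff_X_pow, if_neg (by omega), zero_smul]
  · simp

end shift

theorem X_mul_cancel_left {A : Type*} [Ring A] {f g : A⟦X⟧} (h : X * f = X * g) : f = g := by
  ext n
  rw [← coeff_succ_X_mul, h, coeff_succ_X_mul]

/-! ### Specializing a series in two variables at `v = u + a`. -/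

section evalShift

variable {A : Type*} [Ring A] [Algebra ℂ A]

/-- The expansion of `(u + a)⁻¹` in powers of `u⁻¹`, as a central element of `A⟦X⟧`. -/
noncomputable def invShiftIn (A : Type*) [Ring A] [Algebra ℂ A] (a : ℂ) : A⟦X⟧ :=
  PowerSeries.map (algebraMap ℂ A) (invShift a)

theorem commute_map_algebraMap (p : ℂ⟦X⟧) (f : A⟦X⟧) :
    Commute (PowerSeries.map (algebraMap ℂ A) p) f := by
  ext n
  rw [coeff_mul, coeff_mul]
  refine Finset.sum_equiv (Equiv.prodComm ℕ ℕ)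
    (by simp [Finset.HasAntidiagonal.mem_antidiagonal, add_comm]) fun q _ => ?_
  rw [coeff_map]
  simpa using Algebra.commutes _ _

theorem coeff_mul_invShiftIn_pow_of_lt (a : ℂ) (f : A⟦X⟧) {n s : ℕ} (h : n < s) :
    coeff n (f * invShiftIn A a ^ s) = 0 := by
  rw [coeff_mul]
  refine Finset.sum_eq_zero fun q hq => ?_
  have := Finset.HasAntidiagonal.mem_antidiagonal.1 hq
  rw [invShiftIn, ← map_pow, coeff_map, coeff_invShift_pow_of_lt a (by omega), map_zero, mul_zero]

/-- The sum `∑_s g_s(u) (u + a)^{-s}`. -/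
noncomputable def evalShift (a : ℂ) (g : ℕ → A⟦X⟧) : A⟦X⟧ :=
  PowerSeries.mk fun n => ∑ s ∈ Finset.range (n + 1), coeff n (g s * invShiftIn A a ^ s)

theorem coeff_evalShift (a : ℂ) (g : ℕ → A⟦X⟧) {n m : ℕ} (h : n ≤ m) :
    coeff n (evalShift a g) =
      ∑ s ∈ Finset.range (m + 1), coeff n (g s * invShiftIn A a ^ s) := by
  rw [evalShift, coeff_mk]
  refine Finset.sum_subset (Finset.range_mono (by omega)) fun r _ hr => ?_
  rw [coeff_mul_invShiftIn_pow_of_lt a _ (by simpa using hr)]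

theorem evalShift_add (a : ℂ) (g g' : ℕ → A⟦X⟧) :
    evalShift a (fun s => g s + g' s) = evalShift a g + evalShift a g' := by
  ext n
  simp [evalShift, add_mul, Finset.sum_add_distrib]

theorem evalShift_mul_left (a : ℂ) (f : A⟦X⟧) (g : ℕ → A⟦X⟧) :
    evalShift a (fun s => f * g s) = f * evalShift a g := by
  ext n
  have : ∀ p ∈ Finset.HasAntidiagonal.antidiagonal n, coeff p.1 f * coeff p.2 (evalShift a g) =
      ∑ s ∈ Finset.range (n + 1), coeff p.1 f * coeff p.2 (g s * invShiftIn A a ^ s) := by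
    intro p hp
    have := Finset.HasAntidiagonal.mem_antidiagonal.1 hp
    rw [coeff_evalShift a g (m := n) (by omega), Finset.mul_sum]
  rw [coeff_mul, Finset.sum_congr rfl this, Finset.sum_comm, coeff_evalShift a _ le_rfl]
  refine Finset.sum_congr rfl fun s _ => ?_
  rw [mul_assoc, coeff_mul]

theorem evalShift_mul_right (a : ℂ) (f : A⟦X⟧) (g : ℕ → A⟦X⟧) :
    evalShift a (fun s => g s * f) = evalShift a g * f := by
  ext n
  have : ∀ p ∈ Finset.HasAntidiagonal.antidiagonal n, coeff p.1 (evalShift a g) * coeff p.2 f =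
      ∑ s ∈ Finset.range (n + 1), coeff p.1 (g s * invShiftIn A a ^ s) * coeff p.2 f := by
    intro p hp
    have := Finset.HasAntidiagonal.mem_antidiagonal.1 hp
    rw [coeff_evalShift a g (m := n) (by omega), Finset.sum_mul]
  rw [coeff_mul, Finset.sum_congr rfl this, Finset.sum_comm, coeff_evalShift a _ le_rfl]
  refine Finset.sum_congr rfl fun s _ => ?_
  have hc : Commute (invShiftIn A a ^ s) f := (commute_map_algebraMap (invShift a) f).pow_left s
  rw [mul_assoc, ← hc.eq, ← mul_assoc, coeff_mul]

theorem evalShift_C (a : ℂ) (f : A⟦X⟧) : evalShift a (fun s => C (coeff s f)) = shiftHom a f := by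
  ext n
  rw [coeff_evalShift a _ le_rfl, shiftHom_apply, coeff_shift a _ le_rfl]
  refine Finset.sum_congr rfl fun s _ => ?_
  rw [coeff_C_mul, invShiftIn, ← map_pow, coeff_map, ← Algebra.commutes, Algebra.smul_def]

theorem evalShift_succ (a : ℂ) (g : ℕ → A⟦X⟧) :
    evalShift a g = g 0 + evalShift a (fun s => g (s + 1)) * invShiftIn A a := by
  ext n
  rw [← evalShift_mul_right, coeff_evalShift a g (Nat.le_succ n), Finset.sum_range_succ', map_add,
    coeff_evalShift a _ le_rfl, pow_zero, mul_one, add_comm]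
  congr 1
  refine Finset.sum_congr rfl fun s _ => ?_
  rw [pow_succ', mul_assoc]

theorem invShiftIn_mul_one_sub (c : ℂ) : invShiftIn A (-c) * (1 - c • X) = X := by
  have h := congrArg (PowerSeries.map (algebraMap ℂ A)) (invShift_eq (-c))
  rw [map_mul, map_add, map_mul, map_C, map_X, map_one] at h
  refine Eq.trans ?_ h
  rw [invShiftIn, sub_eq_add_neg]
  congr 2
  ext n
  rw [coeff_C_mul, map_neg, coeff_smul, map_neg, neg_mul, Algebra.smul_def]

/-- For `H(u,v) = ∑ H_s(u) v^{-s}`, and likewise `K`, the hypotheses encode `(u - v) H = K`: with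
`H_0 = 0`, multiplication by `v` moves the index by one, and the identity is divided by `u`. At `v =
u - c` the factor `u - v` is the scalar `c`. -/
theorem smul_evalShift_eq (c : ℂ) {H K : ℕ → A⟦X⟧} (h0 : H 0 = 0)
    (h : ∀ s, H s - X * H (s + 1) = X * K s) :
    c • evalShift (-c) H = evalShift (-c) K := by
  have e1 := evalShift_succ (-c) H
  have e2 : evalShift (-c) H = X * evalShift (-c) (fun s => H (s + 1)) +
      X * evalShift (-c) K := by
    rw [← evalShift_mul_left, ← evalShift_mul_left, ← evalShift_add]
    congr 1
    ext1 s
    rw [← h s]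
    abel
  rw [h0, zero_add] at e1
  set D := evalShift (-c) H
  set D' := evalShift (-c) fun s => H (s + 1)
  set K' := evalShift (-c) K
  have e3 : D * (1 - c • X) = D' * X := by rw [e1, mul_assoc, invShiftIn_mul_one_sub]
  rw [mul_sub, mul_one, mul_smul_comm, ← X_mul, ← X_mul] at e3
  refine X_mul_cancel_left ?_
  rw [mul_smul_comm]
  have e4 : D - X * D' = c • (X * D) := by rw [← e3]; abel
  rw [← e4]
  nth_rw 1 [e2]
  abel

end evalShift

/-! ### From the defining relations to relations between series. -/

section relations

variable {A : Type*} [Ring A] [Algebra ℂ A]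

/-- The relation `(u - v) [x_{i,j}(u), x_{k,l}(v)] = ±(x_{k,j}(u) x_{i,l}(v) - x_{k,j}(v) x_{i,l}(u))`
of the super Yangian, at `v = u - c`. -/
def IsSuperYang {ι : Type*} (s : ι → Fin 2) (x : Matrix ι ι A⟦X⟧) : Prop :=
  ∀ (c : ℂ) (i j k l : ι),
    c • (x i j * shiftHom (-c) (x k l) -
      (-1 : ℤ) ^ (((s i : ℕ) + (s j : ℕ)) * ((s k : ℕ) + (s l : ℕ))) •
        (shiftHom (-c) (x k l) * x i j)) =
    (-1 : ℤ) ^ ((s i : ℕ) * (s j : ℕ) + (s i : ℕ) * (s k : ℕ) + (s j : ℕ) * (s k : ℕ)) •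
      (x k j * shiftHom (-c) (x i l) - shiftHom (-c) (x k j) * x i l)

/-- The relation `(u - v) [x_{i,j}(u), x_{k,l}(v)] = x_{k,j}(u) x_{i,l}(v) - x_{k,j}(v) x_{i,l}(u)`
of the Yangian, at `v = u - c`. -/
def IsYang {ι : Type*} (x : Matrix ι ι A⟦X⟧) : Prop :=
  ∀ (c : ℂ) (i j k l : ι),
    c • (x i j * shiftHom (-c) (x k l) - shiftHom (-c) (x k l) * x i j) =
      x k j * shiftHom (-c) (x i l) - shiftHom (-c) (x k j) * x i l

theorem IsSuperYang.submatrix {ι κ : Type*} {s : ι → Fin 2} {x : Matrix ι ι A⟦X⟧}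
    (hx : IsSuperYang s x) (f : κ → ι) : IsSuperYang (s ∘ f) (x.submatrix f f) :=
  fun c i j k l => hx c (f i) (f j) (f k) (f l)

theorem IsYang.submatrix {ι κ : Type*} {x : Matrix ι ι A⟦X⟧} (hx : IsYang x) (f : κ → ι) :
    IsYang (x.submatrix f f) :=
  fun c i j k l => hx c (f i) (f j) (f k) (f l)

theorem IsSuperYang.isYang {ι : Type*} {s : ι → Fin 2} {x : Matrix ι ι A⟦X⟧}
    (hx : IsSuperYang s x) (hs : ∀ i, s i = 0) : IsYang x := fun c i j k l => by
  simpa [hs] using hx c i j k l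

/-- The relation of the Yangian with the factors on the right-hand side in the opposite order. -/
theorem isYang_of_opposite {ι : Type*} {x : Matrix ι ι A⟦X⟧}
    (hx : ∀ (c : ℂ) (i j k l : ι),
      c • (x i j * shiftHom (-c) (x k l) - shiftHom (-c) (x k l) * x i j) =
        shiftHom (-c) (x i l) * x k j - x i l * shiftHom (-c) (x k j)) : IsYang x := by
  intro c i j k l
  have h := congrArg (shiftHom (-c)) (hx (-c) k l i j)
  simp only [shiftHom_smul, map_sub, map_mul, shiftHom_shiftHom, neg_neg, neg_add_cancel,
    shiftHom_zero] at h
  rw [← h, neg_smul, ← smul_neg, neg_sub]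

variable {k : ℕ} (s : Fin k → Fin 2)

/-- The relation extends to `r = 0` and `q = 0`: the sum is then empty, and the degree zero element
is `0` or an even scalar. -/
theorem gen_rel (i j h l : Fin k) (r q : ℕ) :
    gen s i j r * gen s h l q - (-1 : ℤ) ^ (((s i : ℕ) + (s j : ℕ)) * ((s h : ℕ) + (s l : ℕ))) •
      (gen s h l q * gen s i j r) =
    (-1 : ℤ) ^ ((s i : ℕ) * (s j : ℕ) + (s i : ℕ) * (s h : ℕ) + (s j : ℕ) * (s h : ℕ)) •
      ∑ t ∈ Finset.range (min r q),
        (gen s h j t * gen s i l (r + q - 1 - t) - gen s h j (r + q - 1 - t) * gen s i l t) := by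
  have one : ∀ i : Fin k, gen s i i 0 = 1 := fun i => by simp [gen, preGen]
  have zero : ∀ {i j : Fin k}, i ≠ j → gen s i j 0 = 0 := fun h => by simp [gen, preGen, h]
  rcases Nat.eq_zero_or_pos r with rfl | hr
  · by_cases hij : i = j
    · subst hij
      rw [one, Even.neg_one_pow (Even.mul_right ⟨_, rfl⟩ _)]
      simp
    · rw [zero hij]; simp
  rcases Nat.eq_zero_or_pos q with rfl | hq
  · by_cases hhl : h = l
    · subst hhl
      rw [one, Even.neg_one_pow (Even.mul_left ⟨_, rfl⟩ _)]
      simp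
    · rw [zero hhl]; simp
  have e : mkHom s _ = mkHom s _ := RingQuot.mkAlgHom_rel ℂ (Rel.rtt (s := s) i j h l r q hr hq)
  simp only [map_sub, map_mul, map_pow, map_neg, map_one, map_sum] at e
  simp only [gen, zsmul_eq_mul, Int.cast_pow, Int.cast_neg, Int.cast_one]
  exact e

/-- The sums in the defining relation telescope. This difference is the coefficient form of the
relation multiplied by `u - v`. -/
theorem gen_rel_succ (i j h l : Fin k) (r q : ℕ) :
    (gen s i j (r + 1) * gen s h l q -
      (-1 : ℤ) ^ (((s i : ℕ) + (s j : ℕ)) * ((s h : ℕ) + (s l : ℕ))) •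
        (gen s h l q * gen s i j (r + 1))) -
    (gen s i j r * gen s h l (q + 1) -
      (-1 : ℤ) ^ (((s i : ℕ) + (s j : ℕ)) * ((s h : ℕ) + (s l : ℕ))) •
        (gen s h l (q + 1) * gen s i j r)) =
    (-1 : ℤ) ^ ((s i : ℕ) * (s j : ℕ) + (s i : ℕ) * (s h : ℕ) + (s j : ℕ) * (s h : ℕ)) •
      (gen s h j r * gen s i l q - gen s h j q * gen s i l r) := by
  rw [gen_rel, gen_rel, ← smul_sub]
  congr 1
  have e1 : r + 1 + q - 1 = r + q := by omega
  have e2 : r + (q + 1) - 1 = r + q := by omega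
  rw [e1, e2]
  rcases lt_trichotomy r q with hrq | rfl | hrq
  · rw [min_eq_left (by omega), min_eq_left (by omega), Finset.sum_range_succ, add_sub_cancel_left,
      Nat.add_sub_cancel_left]
  · rw [min_eq_right (by omega), min_eq_left (by omega), sub_self, sub_self]
  · rw [min_eq_right (by omega), min_eq_right (by omega), Finset.sum_range_succ, sub_add_cancel_left,
      Nat.add_sub_cancel, neg_sub]

theorem isSuperYang_tMatrix : IsSuperYang s (tMatrix s) := by
  intro c i j h l
  have coeff_t : ∀ i j r, coeff r (tMatrix s i j) = gen s i j r := fun i j r => by simp [tMatrix]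
  set e1 : ℤ := (-1 : ℤ) ^ (((s i : ℕ) + (s j : ℕ)) * ((s h : ℕ) + (s l : ℕ))) with he1
  set e2 : ℤ := (-1 : ℤ) ^ ((s i : ℕ) * (s j : ℕ) + (s i : ℕ) * (s h : ℕ) + (s j : ℕ) * (s h : ℕ))
    with he2
  -- `H` is the supercommutator and `K` the right-hand side, expanded in powers of `v⁻¹`. The signs
  -- are written as constant right factors so that `evalShift_mul_right` can pull them out.
  have key := smul_evalShift_eq c
    (H := fun q => tMatrix s i j * C (coeff q (tMatrix s h l)) +
      (C (coeff q (tMatrix s h l)) * tMatrix s i j) * C ((-e1 : ℤ) : SuperYangian s))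
    (K := fun q => (tMatrix s h j * C (coeff q (tMatrix s i l))) * C (e2 : SuperYangian s) +
      (C (coeff q (tMatrix s h j)) * tMatrix s i l) * C ((-e2 : ℤ) : SuperYangian s)) ?_ ?_
  · simp only [evalShift_add, evalShift_mul_left, evalShift_mul_right, evalShift_C] at key
    simp only [Int.cast_neg, map_neg, map_intCast, mul_neg, ← sub_eq_add_neg] at key
    rw [zsmul_eq_mul, zsmul_eq_mul, (Int.cast_commute e1 _).eq, (Int.cast_commute e2 _).eq, key,
      sub_mul]
  · ext r
    have g := gen_rel s i j h l r 0
    simp only [coeff_t, map_add, coeff_mul_C, coeff_C_mul]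
    rw [← he1, ← he2] at g
    simp only [min_zero, Finset.range_zero, Finset.sum_empty, smul_zero, zsmul_eq_mul,
      (Int.cast_commute e1 _).eq] at g
    simpa [sub_eq_add_neg] using g
  · intro q
    ext r
    cases r with
    | zero =>
      have g := gen_rel s i j h l 0 q
      rw [← he1, ← he2] at g
      simp only [Nat.zero_min, Finset.range_zero, Finset.sum_empty, smul_zero, zsmul_eq_mul,
        (Int.cast_commute e1 _).eq] at g
      rw [map_sub, coeff_zero_X_mul, coeff_zero_X_mul]
      simp only [coeff_t, map_add, coeff_mul_C, coeff_C_mul]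
      simpa [sub_eq_add_neg] using g
    | succ r =>
      have g := gen_rel_succ s i j h l r q
      rw [← he1, ← he2] at g
      simp only [zsmul_eq_mul, (Int.cast_commute e1 _).eq, (Int.cast_commute e2 _).eq] at g
      rw [map_sub, coeff_succ_X_mul, coeff_succ_X_mul]
      simp only [coeff_t, map_add, coeff_mul_C, coeff_C_mul]
      simpa [sub_eq_add_neg, add_mul] using g

end relations

/-! ### Relations for the inverse matrix. -/

section inverse

variable {A : Type*} [Ring A] [Algebra ℂ A] {ι : Type*} [Fintype ι] [DecidableEq ι]

theorem map_shiftHom_mul_map_shiftHom (a : ℂ) {x x' : Matrix ι ι A⟦X⟧} (h : x * x' = 1) :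
    x.map (shiftHom a) * x'.map (shiftHom a) = 1 := by
  rw [← Matrix.map_mul, h, Matrix.map_one _ (map_zero _) (map_one _)]

theorem neg_one_pow_add_mul_add (a b c : ℕ) :
    (-1 : ℤ) ^ (a * b) * (-1) ^ (a * (b + c)) = (-1) ^ (a * c) := by
  rw [← pow_add, show a * b + a * (b + c) = 2 * (a * b) + a * c by ring, pow_add, pow_mul]
  simp

theorem neg_one_pow_parity (a b c : ℕ) :
    (-1 : ℤ) ^ ((a + b) * c) * (-1) ^ (a * b + a * c + b * c) = (-1) ^ (a * b) := by
  rw [← pow_add, show (a + b) * c + (a * b + a * c + b * c) = 2 * ((a + b) * c) + a * b by ring,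
    pow_add, pow_mul]
  simp

/-- The relations between the entries of a matrix and those of the shifted inverse. -/
theorem IsSuperYang.smul_inv_mul_sub {s : ι → Fin 2} {x x' : Matrix ι ι A⟦X⟧}
    (hx : IsSuperYang s x) (h : x * x' = 1) (h' : x' * x = 1) (c : ℂ) (i j a b : ι) :
    c • ((-1 : ℤ) ^ (((s i : ℕ) + (s j : ℕ)) * (s b : ℕ)) • (shiftHom (-c) (x' a b) * x i j) -
      (-1 : ℤ) ^ (((s i : ℕ) + (s j : ℕ)) * (s a : ℕ)) • (x i j * shiftHom (-c) (x' a b))) =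
    (-1 : ℤ) ^ ((s i : ℕ) * (s j : ℕ)) •
      ((if i = b then (x'.map (shiftHom (-c)) * x) a j else 0) -
        if a = j then (x * x'.map (shiftHom (-c))) i b else 0) := by
  have hy := map_shiftHom_mul_map_shiftHom (-c) h
  have hy' := map_shiftHom_mul_map_shiftHom (-c) h'
  have hy1 : ∀ k b, ∑ l, shiftHom (-c) (x k l) * shiftHom (-c) (x' l b) = if k = b then 1 else 0 :=
    fun k b => by
      have := congrFun (congrFun hy k) b
      rwa [Matrix.mul_apply, Matrix.one_apply] at this
  have hy2 : ∀ a l, ∑ k, shiftHom (-c) (x' a k) * shiftHom (-c) (x k l) = if a = l then 1 else 0 :=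
    fun k b => by
      have := congrFun (congrFun hy' k) b
      rwa [Matrix.mul_apply, Matrix.one_apply] at this
  -- The relation for `(i, j, k, l)` is multiplied by `x'_{a,k}(v)` on the left and `x'_{l,b}(v)` on
  -- the right, and summed over `k` and `l`. The extra sign `(-1)^{(|i|+|j|)|k|}` leaves in each
  -- term a sign that does not depend on the index being contracted: `k` drops out of the second and
  -- fourth terms, `l` out of the first and third.
  have e1 : (-1 : ℤ) ^ (((s i : ℕ) + (s j : ℕ)) * (s b : ℕ)) •
      (shiftHom (-c) (x' a b) * x i j) = ∑ k, ∑ l,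
        (-1 : ℤ) ^ (((s i : ℕ) + (s j : ℕ)) * (s k : ℕ)) • (shiftHom (-c) (x' a k) *
          (x i j * shiftHom (-c) (x k l)) * shiftHom (-c) (x' l b)) := by
    simp only [mul_assoc, ← Finset.smul_sum, ← Finset.mul_sum, hy1]
    simp
  have e2 : (-1 : ℤ) ^ (((s i : ℕ) + (s j : ℕ)) * (s a : ℕ)) •
      (x i j * shiftHom (-c) (x' a b)) = ∑ k, ∑ l,
        (-1 : ℤ) ^ (((s i : ℕ) + (s j : ℕ)) * (s k : ℕ)) • (shiftHom (-c) (x' a k) *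
          ((-1 : ℤ) ^ (((s i : ℕ) + (s j : ℕ)) * ((s k : ℕ) + (s l : ℕ))) •
            (shiftHom (-c) (x k l) * x i j)) * shiftHom (-c) (x' l b)) := by
    simp only [mul_smul_comm, smul_mul_assoc, smul_smul, neg_one_pow_add_mul_add]
    rw [Finset.sum_comm]
    simp only [← mul_assoc, ← Finset.smul_sum, ← Finset.sum_mul, hy2]
    simp
  have e3 : (-1 : ℤ) ^ ((s i : ℕ) * (s j : ℕ)) •
      (if i = b then (x'.map (shiftHom (-c)) * x) a j else 0) = ∑ k, ∑ l,
        (-1 : ℤ) ^ (((s i : ℕ) + (s j : ℕ)) * (s k : ℕ)) • (shiftHom (-c) (x' a k) *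
          ((-1 : ℤ) ^ ((s i : ℕ) * (s j : ℕ) + (s i : ℕ) * (s k : ℕ) + (s j : ℕ) * (s k : ℕ)) •
            (x k j * shiftHom (-c) (x i l))) * shiftHom (-c) (x' l b)) := by
    simp only [mul_smul_comm, smul_mul_assoc, smul_smul, neg_one_pow_parity]
    simp only [mul_assoc, ← Finset.smul_sum, ← Finset.mul_sum, hy1]
    split_ifs <;> simp [Matrix.mul_apply]
  have e4 : (-1 : ℤ) ^ ((s i : ℕ) * (s j : ℕ)) •
      (if a = j then (x * x'.map (shiftHom (-c))) i b else 0) = ∑ k, ∑ l,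
        (-1 : ℤ) ^ (((s i : ℕ) + (s j : ℕ)) * (s k : ℕ)) • (shiftHom (-c) (x' a k) *
          ((-1 : ℤ) ^ ((s i : ℕ) * (s j : ℕ) + (s i : ℕ) * (s k : ℕ) + (s j : ℕ) * (s k : ℕ)) •
            (shiftHom (-c) (x k j) * x i l)) * shiftHom (-c) (x' l b)) := by
    simp only [mul_smul_comm, smul_mul_assoc, smul_smul, neg_one_pow_parity]
    rw [Finset.sum_comm]
    simp only [← mul_assoc, ← Finset.smul_sum, ← Finset.sum_mul, hy2]
    split_ifs <;> simp [Matrix.mul_apply]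
  rw [smul_sub, smul_sub, e1, e2, e3, e4, Finset.smul_sum, Finset.smul_sum, ← Finset.sum_sub_distrib,
    ← Finset.sum_sub_distrib]
  refine Finset.sum_congr rfl fun k _ => ?_
  rw [Finset.smul_sum, Finset.smul_sum, ← Finset.sum_sub_distrib, ← Finset.sum_sub_distrib]
  refine Finset.sum_congr rfl fun l _ => ?_
  rw [← smul_sub, ← smul_sub, ← smul_sub, ← sub_mul, ← mul_sub, smul_comm, ← smul_mul_assoc c,
    ← mul_smul_comm c, hx c i j k l, ← sub_mul, ← mul_sub, smul_sub]

/-- The odd part of the inverse of a matrix with the relations of the super Yangian has the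
relations of the Yangian. -/
theorem IsSuperYang.isYang_inv {s : ι → Fin 2} {x x' : Matrix ι ι A⟦X⟧} (hx : IsSuperYang s x)
    (h : x * x' = 1) (h' : x' * x = 1) {κ : Type*} (f : κ → ι) (hf : ∀ a, s (f a) = 1) :
    IsYang (x'.submatrix f f) := by
  refine isYang_of_opposite fun c i j k l => ?_
  simp only [Matrix.submatrix_apply]
  have hk := hf k
  have hl := hf l
  generalize f i = p, f j = q at *
  generalize f k = a at *
  generalize f l = b at *
  -- Since `a` and `b` are odd, the signs cancel in each parity case: an even `i` cannot equal `b`,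
  -- an even `j` cannot equal `a`, and the remaining signs agree.
  have key : ∀ i j, c • (x i j * shiftHom (-c) (x' a b) - shiftHom (-c) (x' a b) * x i j) =
      (if i = b then (x'.map (shiftHom (-c)) * x) a j else 0) -
        if a = j then (x * x'.map (shiftHom (-c))) i b else 0 := by
    intro i j
    have e := hx.smul_inv_mul_sub h h' c i j a b
    have hi : s i = 0 → i ≠ b := fun h0 hb => by rw [hb, hl] at h0; exact one_ne_zero h0
    have hj : s j = 0 → a ≠ j := fun h0 hb => by rw [← hb, hk] at h0; exact one_ne_zero h0
    have two : ∀ t : Fin 2, t = 0 ∨ t = 1 := by decide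
    rw [hk, hl] at e
    rcases two (s i) with h0 | h0 <;> rcases two (s j) with h1 | h1
    · rw [if_neg (hi h0), if_neg (hj h1)] at e ⊢
      rw [h0, h1] at e
      simp only [Fin.val_zero, add_zero, zero_mul, pow_zero, one_smul, sub_zero] at e
      rw [← neg_sub, smul_neg, e, neg_zero, sub_zero]
    · rw [h0, h1] at e
      rw [if_neg (hi h0)] at e ⊢
      simpa [sub_eq_add_neg, add_comm] using e
    · rw [h0, h1] at e
      rw [if_neg (hj h1)] at e ⊢
      simpa [sub_eq_add_neg, add_comm] using e
    · rw [h0, h1] at e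
      simp only [Fin.val_one, mul_one, Nat.reduceAdd, even_two, Even.neg_pow, one_pow, one_smul,
        pow_one, neg_smul] at e
      rw [← neg_sub, smul_neg, e, neg_neg]
  have h1 : ∀ i l, ∑ k, x i k * x' k l = if i = l then 1 else 0 := fun i l => by
    have := congrFun (congrFun h i) l
    rwa [Matrix.mul_apply, Matrix.one_apply] at this
  have h2 : ∀ i l, ∑ k, x' i k * x k l = if i = l then 1 else 0 := fun i l => by
    have := congrFun (congrFun h' i) l
    rwa [Matrix.mul_apply, Matrix.one_apply] at this
  -- Multiplying `key` by `x'_{p,i}(u)` on the left and `x'_{j,q}(u)` on the right and summing over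
  -- `i` and `j` replaces the entries of `x` by those of `x'`; the factors on the right come out in
  -- the opposite order.
  have e1 : shiftHom (-c) (x' a b) * x' p q = ∑ i, ∑ j,
      x' p i * (x i j * shiftHom (-c) (x' a b)) * x' j q := by
    rw [Finset.sum_comm]
    simp only [← mul_assoc, ← Finset.sum_mul, h2]
    simp
  have e2 : x' p q * shiftHom (-c) (x' a b) = ∑ i, ∑ j,
      x' p i * (shiftHom (-c) (x' a b) * x i j) * x' j q := by
    simp only [mul_assoc, ← Finset.mul_sum, h1]
    simp
  have e3 : x' p b * shiftHom (-c) (x' a q) = ∑ i, ∑ j,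
      x' p i * (if i = b then (x'.map (shiftHom (-c)) * x) a j else 0) * x' j q := by
    have : (x'.map (shiftHom (-c)) * x * x') a q = shiftHom (-c) (x' a q) := by
      rw [mul_assoc, h, mul_one, Matrix.map_apply]
    rw [← this, Matrix.mul_apply, Finset.sum_comm, Finset.mul_sum]
    simp [mul_assoc]
  have e4 : shiftHom (-c) (x' p b) * x' a q = ∑ i, ∑ j,
      x' p i * (if a = j then (x * x'.map (shiftHom (-c))) i b else 0) * x' j q := by
    have : (x' * (x * x'.map (shiftHom (-c)))) p b = shiftHom (-c) (x' p b) := by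
      rw [← mul_assoc, h', one_mul, Matrix.map_apply]
    rw [← this, Matrix.mul_apply, Finset.sum_mul]
    simp
  rw [e1, e2, e3, e4, ← neg_sub, smul_neg, neg_eq_iff_eq_neg, neg_sub]
  simp only [Finset.smul_sum, ← Finset.sum_sub_distrib]
  refine Finset.sum_congr rfl fun i _ => Finset.sum_congr rfl fun j _ => ?_
  rw [← sub_mul, ← mul_sub, ← sub_mul, ← mul_sub, ← key i j, mul_smul_comm, smul_mul_assoc]

theorem IsYang.isSuperYang {ι : Type*} {x : Matrix ι ι A⟦X⟧} (hx : IsYang x) :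
    IsSuperYang (fun _ => 0) x := fun c i j k l => by
  simpa using hx c i j k l

theorem IsYang.commute_shiftHom_inv {x x' : Matrix ι ι A⟦X⟧} (hx : IsYang x) (h : x * x' = 1)
    (h' : x' * x = 1) {c : ℂ} (hc : c ≠ 0) {i j a b : ι} (hi : i ≠ b) (hj : a ≠ j) :
    Commute (x i j) (shiftHom (-c) (x' a b)) := by
  have e := hx.isSuperYang.smul_inv_mul_sub h h' c i j a b
  rw [if_neg hi, if_neg hj] at e
  simp only [Fin.val_zero, add_zero, mul_zero, pow_zero, one_smul, sub_zero] at e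
  exact (sub_eq_zero.1 ((smul_eq_zero_iff_right hc).1 e)).symm

end inverse

/-! ### Manin relations for rows and columns of a Yangian matrix. -/

section qdet

variable {A : Type*} [Ring A] [Algebra ℂ A]

/-- At `c = 1`, taking equal columns cancels the terms with `u - 1` on the left; for two different
columns these terms cancel on adding the relation with the columns exchanged. -/
theorem IsYang.isManin_col {n : ℕ} {x : Matrix (Fin n) (Fin n) A⟦X⟧} (hx : IsYang x) :
    IsManin (n := n) fun p j i => shiftHom (-(p : ℂ)) (x i j) := by
  have e : ∀ p : ℕ, -((p + 1 : ℕ) : ℂ) = -(p : ℂ) + -1 := fun p => by push_cast; ring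
  have r : ∀ i j k l, x i j * shiftHom (-1) (x k l) - shiftHom (-1) (x k l) * x i j =
      x k j * shiftHom (-1) (x i l) - shiftHom (-1) (x k j) * x i l := fun i j k l => by
    simpa using hx 1 i j k l
  refine ⟨fun p _ a b i k => ?_, fun p _ a i k => ?_⟩
  all_goals
    simp only [e, ← shiftHom_shiftHom, ← map_mul, ← map_add]
    congr 1
  · have h1 := r i a k b
    have h2 := r i b k a
    rw [sub_eq_iff_eq_add] at h1 h2
    rw [h1, h2]
    abel
  · have h1 := r i a k a
    rwa [sub_left_inj] at h1

/-- The shifts increase from left to right, opposite to the column case: now the products with `u -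
1` on the left survive. -/
theorem IsYang.isManin_row {n : ℕ} {x : Matrix (Fin n) (Fin n) A⟦X⟧} (hx : IsYang x) (t : ℂ) :
    IsManin (n := n) fun p j i => shiftHom ((p : ℂ) + t) (x j i) := by
  have e : ∀ p : ℕ, (p : ℂ) + t = ((p + 1 : ℕ) : ℂ) + t + -1 := fun p => by push_cast; ring
  have r : ∀ i j k l, x i j * shiftHom (-1) (x k l) - shiftHom (-1) (x k l) * x i j =
      x k j * shiftHom (-1) (x i l) - shiftHom (-1) (x k j) * x i l := fun i j k l => by
    simpa using hx 1 i j k l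
  refine ⟨fun p _ a b i k => ?_, fun p _ a i k => ?_⟩
  all_goals
    rw [e p]
    simp only [← shiftHom_shiftHom, ← map_mul, ← map_add]
    congr 2
  · have h1 := r b k a i
    have h2 := r a k b i
    linear_combination (norm := abel1) -h1 - h2
  · exact sub_right_inj.1 (r a k a i)

/-- The row form of the quantum determinant,
`∑_σ sgn(σ) x_{1,σ(1)}(u-n+1) ⋯ x_{n,σ(n)}(u)`. -/
noncomputable def rowDet {n : ℕ} (x : Matrix (Fin n) (Fin n) A⟦X⟧) : A⟦X⟧ :=
  ndet fun p i => shiftHom ((p : ℂ) + (1 - n)) (x p i)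

theorem qdet_eq_ndet {n : ℕ} (x : Matrix (Fin n) (Fin n) A⟦X⟧) :
    qdet x = ndet fun p i => shiftHom (-(p : ℂ)) (x i p) := rfl

theorem ndet_succ {R : Type*} [Ring R] {n : ℕ} (W : Fin (n + 1) → Fin (n + 1) → R)
    (hW : ∀ i : Fin n, W 0 i.succ = 0) :
    ndet W = W 0 0 * ndet fun p i : Fin n => W p.succ i.succ := by
  have gen : ∀ {m : ℕ} (h : 1 + n = m) (W : Fin m → Fin m → R),
      (∀ p i : Fin m, (p : ℕ) < 1 → 1 ≤ (i : ℕ) → W p i = 0) →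
      ndet W = W (Fin.cast h (Fin.castAdd n 0)) (Fin.cast h (Fin.castAdd n 0)) *
        ndet fun p i : Fin n => W (Fin.cast h (Fin.natAdd 1 p)) (Fin.cast h (Fin.natAdd 1 i)) := by
    rintro m rfl W hW
    rw [ndet_add W (Or.inl hW), ndet_one]
    rfl
  have e : ∀ p : Fin n, Fin.cast (Nat.add_comm 1 n) (Fin.natAdd 1 p) = p.succ := fun p => by
    ext; simp
  rw [gen (Nat.add_comm 1 n) W]
  · simp only [e]
    rfl
  · intro p i hp hi
    obtain rfl : p = 0 := by ext; simpa using hp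
    have hi0 : i ≠ 0 := by rintro rfl; simp at hi
    obtain ⟨j, rfl⟩ := Fin.exists_succ_eq.2 hi0
    exact hW j

end qdet

/-! ### Schur complements over a noncommutative ring. -/

section schur

variable {R : Type*} [Ring R] {n : ℕ}

/-- The last entry of the inverse of a matrix is inverse to the Schur complement. -/
theorem schur_mul_inv_last {x x' : Matrix (Fin (n + 1)) (Fin (n + 1)) R}
    {y' : Matrix (Fin n) (Fin n) R} (h : x * x' = 1)
    (hy' : y' * x.submatrix Fin.castSucc Fin.castSucc = 1) :
    (x (Fin.last n) (Fin.last n) - ∑ b, x (Fin.last n) (Fin.castSucc b) *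
      ∑ a, y' b a * x (Fin.castSucc a) (Fin.last n)) * x' (Fin.last n) (Fin.last n) = 1 := by
  have h1 : ∀ i, ∑ k : Fin n, x i k.castSucc * x' k.castSucc (Fin.last n) =
      (if i = Fin.last n then 1 else 0) - x i (Fin.last n) * x' (Fin.last n) (Fin.last n) := by
    intro i
    have := congrFun (congrFun h i) (Fin.last n)
    rw [Matrix.mul_apply, Matrix.one_apply, Fin.sum_univ_castSucc] at this
    rw [← this, add_sub_cancel_right]
  have h2 : ∀ b : Fin n, ∑ a, y' b a * x a.castSucc (Fin.last n) * x' (Fin.last n) (Fin.last n) =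
      -x' b.castSucc (Fin.last n) := by
    intro b
    have e : ∀ a : Fin n, x a.castSucc (Fin.last n) * x' (Fin.last n) (Fin.last n) =
        -∑ k : Fin n, x a.castSucc k.castSucc * x' k.castSucc (Fin.last n) := by
      intro a
      rw [h1, if_neg (Fin.castSucc_lt_last a).ne, zero_sub, neg_neg]
    have h3 : ∀ k, ∑ a, y' b a * x a.castSucc k.castSucc = if b = k then 1 else 0 := by
      intro k
      have := congrFun (congrFun hy' b) k
      rwa [Matrix.mul_apply, Matrix.one_apply] at this
    simp only [mul_assoc, e, mul_neg, Finset.mul_sum, Finset.sum_neg_distrib]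
    rw [Finset.sum_comm]
    simp only [← mul_assoc, ← Finset.sum_mul, h3]
    simp
  rw [sub_mul, Finset.sum_mul]
  simp only [mul_assoc, Finset.sum_mul]
  simp only [← mul_assoc, h2, mul_neg, Finset.sum_neg_distrib, h1]
  simp

theorem inv_last_mul_schur {x x' : Matrix (Fin (n + 1)) (Fin (n + 1)) R}
    {y' : Matrix (Fin n) (Fin n) R} (h' : x' * x = 1)
    (hy : x.submatrix Fin.castSucc Fin.castSucc * y' = 1) :
    x' (Fin.last n) (Fin.last n) * (x (Fin.last n) (Fin.last n) -
      ∑ b, (∑ a, x (Fin.last n) (Fin.castSucc a) * y' a b) *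
        x (Fin.castSucc b) (Fin.last n)) = 1 := by
  have h1 : ∀ i, ∑ k : Fin n, x' (Fin.last n) k.castSucc * x k.castSucc i =
      (if Fin.last n = i then 1 else 0) - x' (Fin.last n) (Fin.last n) * x (Fin.last n) i := by
    intro i
    have := congrFun (congrFun h' (Fin.last n)) i
    rw [Matrix.mul_apply, Matrix.one_apply, Fin.sum_univ_castSucc] at this
    rw [← this, add_sub_cancel_right]
  have h2 : ∀ b : Fin n, ∑ a, x' (Fin.last n) (Fin.last n) * (x (Fin.last n) a.castSucc * y' a b) =
      -x' (Fin.last n) b.castSucc := by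
    intro b
    have e : ∀ a : Fin n, x' (Fin.last n) (Fin.last n) * x (Fin.last n) a.castSucc =
        -∑ k : Fin n, x' (Fin.last n) k.castSucc * x k.castSucc a.castSucc := by
      intro a
      rw [h1, if_neg (Fin.castSucc_lt_last a).ne', zero_sub, neg_neg]
    have h3 : ∀ k, ∑ a, x (Fin.castSucc k) a.castSucc * y' a b = if k = b then 1 else 0 := by
      intro k
      have := congrFun (congrFun hy k) b
      rwa [Matrix.mul_apply, Matrix.one_apply] at this
    simp only [← mul_assoc, e, neg_mul, Finset.sum_mul, Finset.sum_neg_distrib]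
    rw [Finset.sum_comm]
    simp only [mul_assoc, ← Finset.mul_sum, h3]
    simp
  rw [mul_sub, Finset.mul_sum]
  simp only [← mul_assoc, Finset.mul_sum]
  simp only [mul_assoc, h2, neg_mul, Finset.sum_neg_distrib, h1]
  simp

end schur

/-! ### Agreement of the column and row quantum determinants. -/

section rowDet

variable {A : Type*} [Ring A] [Algebra ℂ A]

/-- Permuting the rows and permuting the columns each contribute the sign of `τ`, and the two signs
cancel. -/
theorem rowDet_submatrix {n : ℕ} {x : Matrix (Fin n) (Fin n) A⟦X⟧} (hx : IsYang x)
    (τ : Equiv.Perm (Fin n)) : rowDet (x.submatrix τ τ) = rowDet x := by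
  have h := (hx.isManin_row (1 - n)).ndet_perm τ
  simp only [rowDet, Matrix.submatrix_apply]
  rw [ndet_comp_perm (fun p i => shiftHom ((p : ℂ) + (1 - n)) (x (τ p) i)) τ, h, smul_smul]
  simp

theorem commute_ndet {R : Type*} [Ring R] {n : ℕ} {W : Fin n → Fin n → R} {z : R}
    (h : ∀ p i, Commute (W p i) z) : Commute (ndet W) z := by
  refine Commute.sum_left _ _ _ fun σ _ => ?_
  have hc : Commute (List.ofFn fun p => W p (σ p)).prod z := by
    refine Commute.list_prod_left _ _ fun y hy => ?_
    obtain ⟨p, rfl⟩ := (List.mem_ofFn' _ _).1 hy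
    exact h _ _
  rcases Int.units_eq_one_or (Equiv.Perm.sign σ) with h1 | h1 <;> rw [h1]
  · simpa using hc
  · simpa using hc.neg_left

/-- Column elimination: right multiples of the earlier columns, with coefficients from `y'`, clear
the last column above its final entry and leave the Schur complement there. It sits in the last
position, hence the shift by `-n` and the right-hand factor. -/
theorem qdet_succ {n : ℕ} {x : Matrix (Fin (n + 1)) (Fin (n + 1)) A⟦X⟧} (hx : IsYang x)
    {y' : Matrix (Fin n) (Fin n) A⟦X⟧} (hy : x.submatrix Fin.castSucc Fin.castSucc * y' = 1) :
    qdet x = qdet (x.submatrix Fin.castSucc Fin.castSucc) *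
      shiftHom (-(n : ℂ)) (x (Fin.last n) (Fin.last n) - ∑ b, x (Fin.last n) (Fin.castSucc b) *
        ∑ a, y' b a * x (Fin.castSucc a) (Fin.last n)) := by
  let e : Fin (n + 1) → Fin (n + 1) → A⟦X⟧ := fun q => Fin.lastCases 0 fun b : Fin n =>
    if q = Fin.last n then -shiftHom (-(n : ℂ)) (∑ a, y' b a * x a.castSucc (Fin.last n)) else 0
  let P : Fin (n + 1) → Fin (n + 1) → A⟦X⟧ := fun q i =>
    shiftHom (-((q : ℕ) : ℂ)) (x i q) + ∑ j, shiftHom (-((q : ℕ) : ℂ)) (x i j) * e q j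
  have hP0 : ∀ p i, P (Fin.castSucc p) i = shiftHom (-((p : ℕ) : ℂ)) (x i p.castSucc) := by
    intro p i
    simp only [P, e]
    rw [Finset.sum_eq_zero, add_zero, Fin.val_castSucc]
    intro j _
    refine Fin.lastCases (by simp) (fun b => ?_) j
    rw [Fin.lastCases_castSucc, if_neg (Fin.castSucc_lt_last p).ne, mul_zero]
  have hPl : ∀ i, P (Fin.last n) i = shiftHom (-(n : ℂ)) (x i (Fin.last n) -
      ∑ b, x i (Fin.castSucc b) * ∑ a, y' b a * x (Fin.castSucc a) (Fin.last n)) := by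
    intro i
    simp only [P, e]
    rw [Fin.sum_univ_castSucc]
    simp [sub_eq_add_neg]
  have h := hx.isManin_col.ndet_eq_of_add_earlier (P := P) e (fun q j hqj => ?_) fun q i => rfl
  · rw [qdet_eq_ndet, ← h, ndet_add (k := n) (l := 1) P (Or.inr fun p i hp hi => ?_), ndet_one]
    · congr 1
      · rw [qdet_eq_ndet]
        congr 1
        ext1 p
        ext1 i
        exact hP0 p _
      · exact hPl _
    · obtain rfl : p = Fin.last n := by
        ext
        have := p.2
        simp at this ⊢
        omega
      obtain ⟨i, rfl⟩ : ∃ i', Fin.castSucc i' = i := ⟨⟨i, hi⟩, rfl⟩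
      rw [hPl]
      have h3 : ∀ a, ∑ b, x i.castSucc (Fin.castSucc b) * y' b a = if i = a then 1 else 0 := by
        intro a
        have := congrFun (congrFun hy i) a
        rwa [Matrix.mul_apply, Matrix.one_apply] at this
      simp only [Finset.mul_sum]
      rw [Finset.sum_comm]
      simp only [← mul_assoc, ← Finset.sum_mul, h3]
      simp
  · revert hqj
    refine Fin.lastCases (fun _ => by simp [e]) (fun b hqj => ?_) j
    simp only [e]
    rw [Fin.lastCases_castSucc, if_neg]
    rintro rfl
    exact absurd (Fin.castSucc_lt_last b) hqj.not_gt

theorem rowDet_succ {n : ℕ} {x : Matrix (Fin (n + 1)) (Fin (n + 1)) A⟦X⟧} (hx : IsYang x)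
    {y' : Matrix (Fin n) (Fin n) A⟦X⟧} (hy' : y' * x.submatrix Fin.castSucc Fin.castSucc = 1) :
    rowDet x = shiftHom (-(n : ℂ)) (x (Fin.last n) (Fin.last n) -
      ∑ b, (∑ a, x (Fin.last n) (Fin.castSucc a) * y' a b) * x (Fin.castSucc b) (Fin.last n)) *
        rowDet (x.submatrix Fin.castSucc Fin.castSucc) := by
  -- Row operations may only add later rows, so the last row, which is to be cleared, is first
  -- rotated to the front. Position `0` carries the shift `1 - (n + 1) = -n`.
  let τ : Equiv.Perm (Fin (n + 1)) := (finRotate (n + 1)).symm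
  have τ0 : τ 0 = Fin.last n := (Equiv.symm_apply_eq _).2 (by simp)
  have τs : ∀ i : Fin n, τ i.succ = i.castSucc := fun i =>
    (Equiv.symm_apply_eq _).2 (by simp)
  let e : Fin (n + 1) → Fin (n + 1) → A⟦X⟧ := fun q => Fin.cases 0 fun b : Fin n =>
    if q = 0 then -shiftHom (-(n : ℂ)) (∑ a, x (Fin.last n) (Fin.castSucc a) * y' a b) else 0
  let P : Fin (n + 1) → Fin (n + 1) → A⟦X⟧ := fun q i =>
    shiftHom (((q : ℕ) : ℂ) + (1 - (n + 1 : ℕ))) (x (τ q) (τ i)) +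
      ∑ j, e q j * shiftHom (((q : ℕ) : ℂ) + (1 - (n + 1 : ℕ))) (x (τ j) (τ i))
  have hPs : ∀ p i, P (Fin.succ p) i =
      shiftHom (((p : ℕ) : ℂ) + (1 - n)) (x p.castSucc (τ i)) := by
    intro p i
    simp only [P, e]
    rw [Finset.sum_eq_zero, add_zero, τs, Fin.val_succ]
    · congr 1
      push_cast
      ring_nf
    intro j _
    refine Fin.cases (by simp) (fun b => ?_) j
    rw [Fin.cases_succ, if_neg (Fin.succ_ne_zero p), zero_mul]
  have hP0 : ∀ i, P 0 i = shiftHom (-(n : ℂ)) (x (Fin.last n) (τ i) -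
      ∑ b, (∑ a, x (Fin.last n) (Fin.castSucc a) * y' a b) * x (Fin.castSucc b) (τ i)) := by
    intro i
    simp only [P, e]
    rw [Fin.sum_univ_succ]
    simp [sub_eq_add_neg, τ0, τs]
  have h := ((hx.submatrix τ).isManin_row (1 - (n + 1 : ℕ))).ndet_eq_of_add_later (P := P) e
    (fun q j hqj => ?_) fun q i => rfl
  · rw [← rowDet_submatrix hx τ, rowDet, ← h, ndet_succ]
    · congr 1
      · rw [hP0, τ0]
      · rw [rowDet]
        congr 1
        ext1 p
        ext1 i
        rw [hPs, τs]
        rfl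
    · intro i
      rw [hP0, τs]
      have h3 : ∀ a, ∑ b, y' a b * x (Fin.castSucc b) i.castSucc = if a = i then 1 else 0 := by
        intro a
        have := congrFun (congrFun hy' a) i
        rwa [Matrix.mul_apply, Matrix.one_apply] at this
      simp only [Finset.sum_mul]
      rw [Finset.sum_comm]
      simp only [mul_assoc, ← Finset.mul_sum, h3]
      simp
  · revert hqj
    refine Fin.cases (fun _ => by simp [e]) (fun b hqj => ?_) j
    simp only [e]
    rw [Fin.cases_succ, if_neg]
    rintro rfl
    simp at hqj

theorem exists_inv_of_constantCoeff {A : Type*} [Ring A] {n : ℕ}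
    {x : Matrix (Fin n) (Fin n) A⟦X⟧}
    (hc : ∀ i j, constantCoeff (x i j) = if i = j then 1 else 0) : ∃ y, x * y = 1 ∧ y * x = 1 := by
  obtain ⟨u, rfl⟩ := isUnit_of_constantCoeff hc
  exact ⟨(u⁻¹ : _ˣ), u.mul_inv, u.inv_mul⟩

/-- The column and row forms of the quantum determinant agree. -/
theorem IsYang.qdet_eq_rowDet {n : ℕ} {x : Matrix (Fin n) (Fin n) A⟦X⟧} (hx : IsYang x)
    (hc : ∀ i j, constantCoeff (x i j) = if i = j then 1 else 0) : qdet x = rowDet x := by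
  induction n with
  | zero => rw [qdet_eq_ndet, rowDet, ndet_zero, ndet_zero]
  | succ n ih =>
    obtain ⟨x', hz, hz'⟩ := exists_inv_of_constantCoeff hc
    have hc' : ∀ i j, constantCoeff (x.submatrix Fin.castSucc Fin.castSucc i j) =
        if i = j then 1 else 0 := fun i j => by simp [hc]
    obtain ⟨y', hy, hy'⟩ := exists_inv_of_constantCoeff hc'
    have h1 := schur_mul_inv_last hz hy'
    have h2 := inv_last_mul_schur hz' hy
    rw [qdet_succ hx hy, rowDet_succ hx hy', ← ih (hx.submatrix _) hc']
    have e : ∑ b, x (Fin.last n) (Fin.castSucc b) *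
        ∑ a, y' b a * x (Fin.castSucc a) (Fin.last n) =
        ∑ b, (∑ a, x (Fin.last n) (Fin.castSucc a) * y' a b) *
          x (Fin.castSucc b) (Fin.last n) := by
      simp only [Finset.mul_sum, Finset.sum_mul]
      rw [Finset.sum_comm]
      simp only [mul_assoc]
    rw [e] at h1 ⊢
    set d := x (Fin.last n) (Fin.last n) -
      ∑ b, (∑ a, x (Fin.last n) (Fin.castSucc a) * y' a b) *
        x (Fin.castSucc b) (Fin.last n)
    -- Column `p` of the corner is evaluated at `u - p` and the entry of the inverse at `u - n`.
    -- Their difference `n - p` is nonzero, so the relation forces the entries to commute.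
    have h3 : Commute (qdet (x.submatrix Fin.castSucc Fin.castSucc))
        (shiftHom (-(n : ℂ)) (x' (Fin.last n) (Fin.last n))) := by
      rw [qdet_eq_ndet]
      refine commute_ndet fun p i => ?_
      have hne : (n : ℂ) - (p : ℕ) ≠ 0 := sub_ne_zero.2 (by exact_mod_cast p.2.ne')
      have h4 := (hx.commute_shiftHom_inv hz hz' hne
        (i := i.castSucc) (j := p.castSucc) (a := Fin.last n) (b := Fin.last n)
        (Fin.castSucc_lt_last _).ne (Fin.castSucc_lt_last _).ne').map (shiftHom (-((p : ℕ) : ℂ)))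
      rw [shiftHom_shiftHom] at h4
      rwa [show -((p : ℕ) : ℂ) + -((n : ℂ) - (p : ℕ)) = -(n : ℂ) by ring] at h4
    -- The Schur complement is inverse to that entry, so it commutes with the corner determinant as
    -- well.
    let U : (A⟦X⟧)ˣ := ⟨shiftHom (-(n : ℂ)) (x' (Fin.last n) (Fin.last n)),
      shiftHom (-(n : ℂ)) d, by rw [← map_mul, h2, map_one], by rw [← map_mul, h1, map_one]⟩
    exact (Commute.units_inv_right (u := U) h3).eq

end rowDet

/-! ### Inverses of block triangular matrices. -/

section blocks

variable {R : Type*} [Ring R]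

theorem map_ndet {S : Type*} [Ring S] (f : R →+* S) {n : ℕ} (W : Fin n → Fin n → R) :
    f (ndet W) = ndet fun p i => f (W p i) := by
  rw [ndet, ndet, map_sum]
  refine Finset.sum_congr rfl fun σ _ => ?_
  rw [Units.smul_def, Units.smul_def, map_zsmul, map_list_prod, List.map_ofFn]
  rfl

theorem ndetAt_eq_ndet (W : ℕ → ℕ → R) {a l n : ℕ} (h : l = n) (x : Fin n → Fin n → R)
    (hx : ∀ p i : Fin n, W (a + p) (a + i) = x p i) : ndetAt W a l = ndet x := by
  subst h
  rw [ndetAt]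
  congr 1
  ext1 p
  ext1 i
  exact hx p i

variable {n : ℕ} {β : Type*} [LinearOrder β] {blk : Fin n → β} {G Q : Matrix (Fin n) (Fin n) R}

/-- A column of a right inverse of a block lower triangular matrix, in the first block row in which
it does not vanish. -/
theorem inv_apply_of_blockTriangular (hG : ∀ i j, blk i < blk j → G i j = 0) (hQ : G * Q = 1)
    {l : ℕ} {φ : Fin l → Fin n} (hφ : Function.Injective φ) {a : β}
    (hr : ∀ j, blk j = a ↔ j ∈ Set.range φ) {y : Matrix (Fin l) (Fin l) R}
    (hy : y * G.submatrix φ φ = 1) {j : Fin n} (h0 : ∀ k, blk k < a → Q k j = 0) (k : Fin l) :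
    Q (φ k) j = ∑ i, y k i * if φ i = j then 1 else 0 := by
  have h1 : ∀ i, ∑ k', G (φ i) (φ k') * Q (φ k') j = if φ i = j then 1 else 0 := by
    intro i
    have := congrFun (congrFun hQ (φ i)) j
    rw [Matrix.mul_apply, Matrix.one_apply] at this
    rw [← this]
    refine Finset.sum_of_injOn φ hφ.injOn (by simp) (fun k' _ hk' => ?_) fun _ _ => rfl
    have hne : blk k' ≠ a := fun h => hk' (by simpa using (hr k').1 h)
    rcases lt_or_gt_of_ne hne with h | h
    · rw [h0 k' h, mul_zero]
    · rw [hG, zero_mul]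
      rwa [(hr (φ i)).2 ⟨i, rfl⟩]
  have h2 : ∀ k', ∑ i, y k i * G (φ i) (φ k') = if k = k' then 1 else 0 := by
    intro k'
    have := congrFun (congrFun hy k) k'
    rwa [Matrix.mul_apply, Matrix.one_apply] at this
  simp only [← h1, Finset.mul_sum]
  rw [Finset.sum_comm]
  simp only [← mul_assoc, ← Finset.sum_mul, h2]
  simp

/-- Induction along the block rows: once the entries of a column in earlier block rows vanish, `G *
Q = 1` involves only the diagonal block of the current row, and that block has a left inverse. -/
theorem inv_blockTriangular [WellFoundedLT β] (hG : ∀ i j, blk i < blk j → G i j = 0)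
    (hQ : G * Q = 1)
    (hb : ∀ k, ∃ (l : ℕ) (φ : Fin l → Fin n) (y : Matrix (Fin l) (Fin l) R),
      Function.Injective φ ∧ (∀ j, blk j = blk k ↔ j ∈ Set.range φ) ∧ y * G.submatrix φ φ = 1) :
    ∀ k j, blk k < blk j → Q k j = 0 := by
  suffices ∀ a k j, blk k = a → a < blk j → Q k j = 0 from fun k j h => this _ k j rfl h
  intro a
  induction a using WellFoundedLT.induction with
  | ind a ih =>
    rintro k j rfl h
    obtain ⟨l, φ, y, hφ, hr, hy⟩ := hb k
    obtain ⟨k', rfl⟩ := (hr k).1 rfl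
    rw [inv_apply_of_blockTriangular hG hQ hφ hr hy
      (fun k'' hk => ih _ hk k'' j rfl (hk.trans h)) k']
    refine Finset.sum_eq_zero fun i _ => ?_
    rw [if_neg, mul_zero]
    rintro rfl
    exact h.ne' ((hr _).2 ⟨i, rfl⟩)

theorem inv_submatrix_of_blockTriangular (hG : ∀ i j, blk i < blk j → G i j = 0) (hQ : G * Q = 1)
    (hQ0 : ∀ k j, blk k < blk j → Q k j = 0)
    {l : ℕ} {φ : Fin l → Fin n} (hφ : Function.Injective φ) {a : β}
    (hr : ∀ j, blk j = a ↔ j ∈ Set.range φ) {y : Matrix (Fin l) (Fin l) R}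
    (hy : y * G.submatrix φ φ = 1) : Q.submatrix φ φ = y := by
  ext k j
  rw [Matrix.submatrix_apply, inv_apply_of_blockTriangular hG hQ hφ hr hy
    (fun k' hk => hQ0 _ _ (by rwa [(hr (φ j)).2 ⟨j, rfl⟩]))]
  simp [hφ.eq_iff]

/-- The inverse of an upper unitriangular matrix is upper unitriangular. -/
theorem inv_apply_of_upper_unitriangular {E' E : Matrix (Fin n) (Fin n) R} (h : E' * E = 1)
    (hE : ∀ i j, j < i → E i j = 0) (hE1 : ∀ i, E i i = 1) :
    ∀ j i, j ≤ i → E' i j = if i = j then 1 else 0 := by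
  intro j
  induction j using WellFoundedLT.induction with
  | ind j ih =>
    intro i hij
    have e := congrFun (congrFun h i) j
    rw [Matrix.mul_apply, Matrix.one_apply, Finset.sum_eq_single j, hE1, mul_one] at e
    · exact e
    · intro k _ hk
      rcases lt_or_gt_of_ne hk with hk | hk
      · rw [ih k hk i (hk.le.trans hij), if_neg (hk.trans_le hij).ne', zero_mul]
      · rw [hE _ _ hk, mul_zero]
    · simp

end blocks

/-! ### Block boundaries of compositions. -/

section composition

variable {k : ℕ} (c : Composition k)

theorem index_lt_iff (i : Fin k) (r : ℕ) : (c.index i : ℕ) < r ↔ (i : ℕ) < c.sizeUpTo r := by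
  constructor
  · intro h
    exact (c.lt_sizeUpTo_index_succ i).trans_le (c.monotone_sizeUpTo h)
  · intro h
    by_contra h'
    exact absurd (c.sizeUpTo_index_le i) (not_le.2 (h.trans_le (c.monotone_sizeUpTo (not_lt.1 h'))))

theorem index_mono {i j : Fin k} (h : i ≤ j) : c.index i ≤ c.index j := by
  have h1 := (index_lt_iff c j (c.index j + 1)).1 (Nat.lt_succ_self _)
  have h2 := (index_lt_iff c i (c.index j + 1)).2 (lt_of_le_of_lt h h1)
  exact Fin.le_def.2 (Nat.lt_succ_iff.1 h2)

theorem index_eq_iff_mem_range (j : Fin k) (a : Fin c.length) :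
    c.index j = a ↔ j ∈ Set.range (c.embedding a) := by
  rw [Composition.mem_range_embedding_iff', eq_comm]

theorem sizeUpTo_append {M N : ℕ} (lam : Composition M) (nu : Composition N) (r : ℕ) :
    (lam.append nu).sizeUpTo r = lam.sizeUpTo r + nu.sizeUpTo (r - lam.length) := by
  simp [Composition.sizeUpTo, Composition.append, Composition.length, List.take_append]

end composition

/-! ### Truncations of the Gauss decomposition and their inverses. -/

section gauss

variable {A : Type*} [Ring A] {k : ℕ} {c : Composition k} {T F D E : Matrix (Fin k) (Fin k) A⟦X⟧}

/-- `F` and `D` are kept together: `FD` is block lower triangular with the `D_a` as diagonal blocks,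
and `T = (FD) E` with `E` upper unitriangular. -/
theorem IsGauss.mul_apply_of_lt (h : IsGauss c T F D E) {i j : Fin k}
    (hij : c.index i < c.index j) : (F * D) i j = 0 := by
  rw [Matrix.mul_apply]
  refine Finset.sum_eq_zero fun a _ => ?_
  by_cases ha : c.index a = c.index j
  · rw [h.F_upper _ _ (by rwa [ha]), zero_mul]
  · rw [h.D_off _ _ ha, mul_zero]

theorem IsGauss.mul_apply_of_eq (h : IsGauss c T F D E) {i j : Fin k}
    (hij : c.index i = c.index j) : (F * D) i j = D i j := by
  rw [Matrix.mul_apply, Finset.sum_eq_single i]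
  · rw [h.F_diag i i rfl, if_pos rfl, one_mul]
  · intro a _ hai
    by_cases ha : c.index a = c.index j
    · rw [h.F_diag _ _ (by rw [ha, hij]), if_neg hai.symm, zero_mul]
    · rw [h.D_off _ _ ha, mul_zero]
  · simp

theorem IsGauss.E_eq_zero_of_lt (h : IsGauss c T F D E) {i j : Fin k} (hij : j < i) :
    E i j = 0 := by
  rcases (index_mono c hij.le).lt_or_eq with h1 | h1
  · exact h.E_lower _ _ h1
  · rw [h.E_diag _ _ h1.symm, if_neg hij.ne']

/-- Truncation of the Gauss decomposition to the first `p` rows and columns. -/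
theorem IsGauss.submatrix_castLE (h : IsGauss c T F D E) {p : ℕ} (hp : p ≤ k) :
    T.submatrix (Fin.castLE hp) (Fin.castLE hp) =
      (F * D).submatrix (Fin.castLE hp) (Fin.castLE hp) *
        E.submatrix (Fin.castLE hp) (Fin.castLE hp) := by
  ext1 i j
  rw [h.eq_mul, Matrix.submatrix_apply, Matrix.mul_apply, Matrix.mul_apply]
  symm
  refine Finset.sum_of_injOn (Fin.castLE hp) (Fin.castLE_injective hp).injOn (by simp)
    (fun a _ ha => ?_) fun _ _ => rfl
  rw [h.E_eq_zero_of_lt, mul_zero]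
  rw [Fin.lt_def, Fin.val_castLE]
  by_contra hlt
  exact ha ⟨⟨a, by omega⟩, by simp, rfl⟩

end gauss

section truncation

variable {A : Type*} [Ring A] {k : ℕ} {c : Composition k} {T F D E : Matrix (Fin k) (Fin k) A⟦X⟧}

theorem exists_embedding_lift {r p : ℕ} (hpr : p = c.sizeUpTo r) (hp : p ≤ k) {a : Fin c.length}
    (ha : (a : ℕ) < r) :
    ∃ φ : Fin (c.blocksFun a) → Fin p, ∀ i, Fin.castLE hp (φ i) = c.embedding a i := by
  refine ⟨fun i => ⟨c.embedding a i, ?_⟩, fun i => rfl⟩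
  rw [hpr, ← index_lt_iff, c.index_embedding]
  exact ha

theorem injective_of_castLE_eq {p : ℕ} {hp : p ≤ k} {a : Fin c.length}
    {φ : Fin (c.blocksFun a) → Fin p} (hφ : ∀ i, Fin.castLE hp (φ i) = c.embedding a i) :
    Function.Injective φ := fun i j h => by
  have := congrArg (Fin.castLE hp) h
  rw [hφ, hφ] at this
  exact (c.embedding a).injective this

theorem index_castLE_eq_iff {p : ℕ} {hp : p ≤ k} {a : Fin c.length}
    {φ : Fin (c.blocksFun a) → Fin p} (hφ : ∀ i, Fin.castLE hp (φ i) = c.embedding a i)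
    (j : Fin p) : c.index (Fin.castLE hp j) = a ↔ j ∈ Set.range φ := by
  rw [index_eq_iff_mem_range]
  constructor
  · rintro ⟨i, hi⟩
    exact ⟨i, Fin.castLE_injective hp ((hφ i).trans hi)⟩
  · rintro ⟨i, rfl⟩
    exact ⟨i, (hφ i).symm⟩

theorem IsGauss.submatrix_mul (h : IsGauss c T F D E) {p : ℕ} {hp : p ≤ k} {a : Fin c.length}
    {φ : Fin (c.blocksFun a) → Fin p} (hφ : ∀ i, Fin.castLE hp (φ i) = c.embedding a i) :
    ((F * D).submatrix (Fin.castLE hp) (Fin.castLE hp)).submatrix φ φ =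
      D.submatrix (c.embedding a) (c.embedding a) := by
  ext1 i j
  simp only [Matrix.submatrix_apply, hφ]
  exact h.mul_apply_of_eq (by rw [c.index_embedding, c.index_embedding])

variable {y : ∀ a, Matrix (Fin (c.blocksFun a)) (Fin (c.blocksFun a)) A⟦X⟧}

/-- The product of the truncated `E` with `x'` is a right inverse of the truncated `FD`. Truncating
at a block boundary keeps every diagonal block whole. -/
theorem IsGauss.mul_inv_apply_of_lt (h : IsGauss c T F D E)
    (hy : ∀ a, y a * D.submatrix (c.embedding a) (c.embedding a) = 1) {r p : ℕ}
    (hpr : p = c.sizeUpTo r) (hp : p ≤ k) {x' : Matrix (Fin p) (Fin p) A⟦X⟧}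
    (hx : T.submatrix (Fin.castLE hp) (Fin.castLE hp) * x' = 1) {i j : Fin p}
    (hij : c.index (Fin.castLE hp i) < c.index (Fin.castLE hp j)) :
    (E.submatrix (Fin.castLE hp) (Fin.castLE hp) * x') i j = 0 := by
  rw [h.submatrix_castLE hp, mul_assoc] at hx
  refine inv_blockTriangular (G := (F * D).submatrix (Fin.castLE hp) (Fin.castLE hp))
    (blk := fun i => c.index (Fin.castLE hp i))
    (fun i j hij => h.mul_apply_of_lt hij) hx (fun l => ?_) i j hij
  have hl : (c.index (Fin.castLE hp l) : ℕ) < r := by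
    rw [index_lt_iff, ← hpr]
    exact l.2
  obtain ⟨φ, hφ⟩ := exists_embedding_lift hpr hp hl
  refine ⟨_, φ, y _, injective_of_castLE_eq hφ, index_castLE_eq_iff hφ, ?_⟩
  rw [h.submatrix_mul hφ, hy]

theorem IsGauss.mul_inv_submatrix (h : IsGauss c T F D E)
    (hy : ∀ a, y a * D.submatrix (c.embedding a) (c.embedding a) = 1) {r p : ℕ}
    (hpr : p = c.sizeUpTo r) (hp : p ≤ k) {x' : Matrix (Fin p) (Fin p) A⟦X⟧}
    (hx : T.submatrix (Fin.castLE hp) (Fin.castLE hp) * x' = 1) {a : Fin c.length}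
    {φ : Fin (c.blocksFun a) → Fin p} (hφ : ∀ i, Fin.castLE hp (φ i) = c.embedding a i) :
    (E.submatrix (Fin.castLE hp) (Fin.castLE hp) * x').submatrix φ φ = y a := by
  have h0 : ∀ i j, c.index (Fin.castLE hp i) < c.index (Fin.castLE hp j) →
      (E.submatrix (Fin.castLE hp) (Fin.castLE hp) * x') i j = 0 :=
    fun i j hij => h.mul_inv_apply_of_lt hy hpr hp hx hij
  rw [h.submatrix_castLE hp, mul_assoc] at hx
  exact inv_submatrix_of_blockTriangular
    (G := (F * D).submatrix (Fin.castLE hp) (Fin.castLE hp))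
    (blk := fun i => c.index (Fin.castLE hp i))
    (fun i j hij => h.mul_apply_of_lt hij) hx h0 (injective_of_castLE_eq hφ)
    (index_castLE_eq_iff hφ) (by rw [h.submatrix_mul hφ, hy])

/-- The inverse of the last diagonal block is a submatrix of the inverse of the truncation. -/
theorem IsGauss.inv_submatrix_last (h : IsGauss c T F D E)
    (hy : ∀ a, y a * D.submatrix (c.embedding a) (c.embedding a) = 1) {a : Fin c.length} {p : ℕ}
    (hpr : p = c.sizeUpTo (a + 1)) (hp : p ≤ k) {x' : Matrix (Fin p) (Fin p) A⟦X⟧}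
    (hx : T.submatrix (Fin.castLE hp) (Fin.castLE hp) * x' = 1)
    {φ : Fin (c.blocksFun a) → Fin p} (hφ : ∀ i, Fin.castLE hp (φ i) = c.embedding a i) :
    x'.submatrix φ φ = y a := by
  rw [← h.mul_inv_submatrix hy hpr hp hx hφ]
  ext1 i j
  simp only [Matrix.submatrix_apply]
  -- In the last block of the truncation the rows of `E` are those of the identity, so multiplying
  -- by `E` has no effect there.
  rw [Matrix.mul_apply, Finset.sum_eq_single (φ i)]
  · rw [Matrix.submatrix_apply, h.E_diag _ _ rfl, if_pos rfl, one_mul]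
  · intro l _ hl
    rw [Matrix.submatrix_apply]
    have h1 : c.index (Fin.castLE hp l) ≤ a := by
      refine Fin.le_def.2 (Nat.lt_succ_iff.1 ((index_lt_iff c _ _).2 ?_))
      rw [Nat.succ_eq_add_one, ← hpr]
      exact l.2
    have h2 : c.index (Fin.castLE hp (φ i)) = a := by rw [hφ, c.index_embedding]
    rcases h1.lt_or_eq with h1 | h1
    · rw [h.E_lower _ _ (by rwa [h2]), zero_mul]
    · rw [h.E_diag _ _ (by rw [h1, h2]), if_neg, zero_mul]
      exact fun e => hl (Fin.castLE_injective hp e).symm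
  · simp

end truncation

/-! ### Yangian relations for the inverse blocks. -/

section blockDInv

variable {k : ℕ} (s : Fin k → Fin 2) (c : Composition k)

theorem blockDInv_mul (a : Fin c.length) : blockDInv s c a *
    (gaussD s c).submatrix (c.embedding a) (c.embedding a) = 1 :=
  (isUnit_blockD s c a).unit.inv_mul

theorem constantCoeff_inv {A : Type*} [Ring A] {n : ℕ} {x x' : Matrix (Fin n) (Fin n) A⟦X⟧}
    (hx : ∀ i j, constantCoeff (x i j) = if i = j then 1 else 0) (h : x' * x = 1) (i j : Fin n) :
    constantCoeff (x' i j) = if i = j then 1 else 0 := by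
  have h1 : x.map (constantCoeff (R := A)) = 1 := by
    ext i j
    rw [Matrix.map_apply, hx, Matrix.one_apply]
  have h2 := congrArg (fun m => Matrix.map m (constantCoeff (R := A))) h
  simp only [Matrix.map_mul, h1, mul_one, Matrix.map_one _ (map_zero _) (map_one _)] at h2
  rw [← Matrix.one_apply, ← h2, Matrix.map_apply]

theorem constantCoeff_blockDInv (a : Fin c.length) (i j : Fin (c.blocksFun a)) :
    constantCoeff (blockDInv s c a i j) = if i = j then 1 else 0 := by
  obtain ⟨F, E, h⟩ := exists_isGauss_gaussD s c
  refine constantCoeff_inv (fun i j => ?_) (blockDInv_mul s c a) i j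
  rw [Matrix.submatrix_apply, h.constantCoeff_D c (constantCoeff_tMatrix s)]
  simp only [EmbeddingLike.apply_eq_iff_eq]

/-- Truncating `T` right after block `a` makes that block last, and `D'_a` becomes a submatrix of
the inverse of the truncation. The truncation still satisfies the super relations, so its odd
inverse entries satisfy the Yangian ones. -/
theorem isYang_blockDInv {a : Fin c.length} (ha : ∀ i, s (c.embedding a i) = 1) :
    IsYang (blockDInv s c a) := by
  obtain ⟨F, E, h⟩ := exists_isGauss_gaussD s c
  have hp := c.sizeUpTo_le (a + 1)
  obtain ⟨φ, hφ⟩ := exists_embedding_lift (c := c) rfl hp (Nat.lt_succ_self a)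
  have hc : ∀ i j, constantCoeff ((tMatrix s).submatrix (Fin.castLE hp) (Fin.castLE hp) i j) =
      if i = j then 1 else 0 := fun i j => by
    rw [Matrix.submatrix_apply, constantCoeff_tMatrix]
    simp only [(Fin.castLE_injective hp).eq_iff]
  obtain ⟨x', hx, hx'⟩ := exists_inv_of_constantCoeff hc
  rw [← h.inv_submatrix_last (blockDInv_mul s c) rfl hp hx hφ]
  refine ((isSuperYang_tMatrix s).submatrix (Fin.castLE hp)).isYang_inv hx hx' φ fun i => ?_
  rw [Function.comp_apply, hφ, ha]

end blockDInv

/-! ### The two factors of the Berezinian. -/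

section berezinian

variable (M N : ℕ) (lam : Composition M) (nu : Composition N)

theorem sizeUpTo_append_of_le {r : ℕ} (hr : r ≤ lam.length) :
    (lam.append nu).sizeUpTo r = lam.sizeUpTo r := by
  rw [sizeUpTo_append, Nat.sub_eq_zero_of_le hr]
  simp

theorem sizeUpTo_append_add (r : ℕ) :
    (lam.append nu).sizeUpTo (lam.length + r) = M + nu.sizeUpTo r := by
  rw [sizeUpTo_append, lam.sizeUpTo_ofLength_le _ (by omega), Nat.add_sub_cancel_left]

theorem embedding_evenBlock (a : Fin lam.length)
    (i : Fin ((lam.append nu).blocksFun (evenBlock lam nu a))) :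
    ((lam.append nu).embedding (evenBlock lam nu a) i : ℕ) = lam.sizeUpTo a + i := by
  rw [Composition.coe_embedding, ← sizeUpTo_append_of_le M N lam nu a.2.le]
  rfl

theorem embedding_oddBlock (b : Fin nu.length)
    (i : Fin ((lam.append nu).blocksFun (oddBlock lam nu b))) :
    ((lam.append nu).embedding (oddBlock lam nu b) i : ℕ) = M + nu.sizeUpTo b + i := by
  rw [Composition.coe_embedding, ← sizeUpTo_append_add M N lam nu]
  rfl

theorem blocksFun_evenBlock (a : Fin lam.length) :
    lam.sizeUpTo (a + 1) - lam.sizeUpTo a = (lam.append nu).blocksFun (evenBlock lam nu a) := by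
  have h := (lam.append nu).sizeUpTo_succ' (evenBlock lam nu a)
  have e : ((evenBlock lam nu a : Fin _) : ℕ) = a := rfl
  rw [e, sizeUpTo_append_of_le M N lam nu a.2.le, sizeUpTo_append_of_le M N lam nu (r := a + 1) a.2] at h
  rw [h, Nat.add_sub_cancel_left]

theorem blocksFun_oddBlock (b : Fin nu.length) :
    nu.sizeUpTo (b + 1) = nu.sizeUpTo b + (lam.append nu).blocksFun (oddBlock lam nu b) := by
  have h := (lam.append nu).sizeUpTo_succ' (oddBlock lam nu b)
  have e : ((oddBlock lam nu b : Fin _) : ℕ) = lam.length + b := rfl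
  rw [e, add_assoc, sizeUpTo_append_add, sizeUpTo_append_add] at h
  omega

/-- The even factor of the quantum Berezinian. -/
theorem evenFactor_eq_prod :
    (∑ ρ : Equiv.Perm (Fin M), Equiv.Perm.sign ρ •
      (List.ofFn fun j : Fin M => shift (-((j : ℕ) : ℂ))
        (tMatrix (stdSeq M N) (Fin.castAdd N (ρ j)) (Fin.castAdd N j))).prod) =
    (List.ofFn fun a : Fin lam.length => shift (-(lam.sizeUpTo a : ℂ))
      (qdet (blockD (stdSeq M N) (lam.append nu) (evenBlock lam nu a)))).prod := by
  set s := stdSeq M N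
  set c := lam.append nu with hcdef
  obtain ⟨F, E, h⟩ := exists_isGauss_gaussD s c
  have hp : M ≤ M + N := Nat.le_add_right M N
  set T := (tMatrix s).submatrix (Fin.castLE hp) (Fin.castLE hp) with hT
  have hYang : IsYang T := ((isSuperYang_tMatrix s).submatrix (Fin.castLE hp)).isYang fun i => by
    simp [s, stdSeq]
  have hE : ∀ i j : Fin M, constantCoeff (E.submatrix (Fin.castLE hp) (Fin.castLE hp) i j) =
      if i = j then 1 else 0 := fun i j => by
    rw [Matrix.submatrix_apply, h.constantCoeff_E]
    simp only [(Fin.castLE_injective hp).eq_iff]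
  obtain ⟨E', hE1, hE2⟩ := exists_inv_of_constantCoeff hE
  have hE' := inv_apply_of_upper_unitriangular hE2 (fun i j hij => h.E_eq_zero_of_lt hij)
    fun i => by rw [Matrix.submatrix_apply, h.E_diag _ _ rfl, if_pos rfl]
  have hG : T * E' = (F * gaussD s c).submatrix (Fin.castLE hp) (Fin.castLE hp) := by
    rw [hT, h.submatrix_castLE hp, mul_assoc, hE1, mul_one]
  -- `E'` is upper unitriangular, so column `q` of `T * E'` is column `q` of `T` plus right
  -- multiples of earlier columns, all at the shift `-q`.
  have h1 := hYang.isManin_col.ndet_eq_of_add_earlier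
    (P := fun q i => shiftHom (-((q : ℕ) : ℂ)) ((T * E') i q))
    (fun q j => if q ≤ j then 0 else shiftHom (-((q : ℕ) : ℂ)) (E' j q))
    (fun q j hqj => by rw [if_pos hqj]) (fun q i => by
      rw [Matrix.mul_apply, map_sum, ← Finset.add_sum_erase _ _ (Finset.mem_univ q),
        ← Finset.add_sum_erase _ (fun j => shiftHom (-((q : ℕ) : ℂ)) (T i j) *
          if q ≤ j then 0 else shiftHom (-((q : ℕ) : ℂ)) (E' j q)) (Finset.mem_univ q),
        if_pos le_rfl, mul_zero, zero_add, hE' q q le_rfl, if_pos rfl, mul_one]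
      congr 1
      refine Finset.sum_congr rfl fun j hj => ?_
      rw [map_mul]
      split_ifs with hqj
      · rw [hE' q j hqj, if_neg (Finset.ne_of_mem_erase hj), map_zero]
      · rfl)
  rw [hG] at h1
  -- Extension by zero to natural indices. The position `p` is the column of `FD`, so block lower
  -- triangularity means vanishing for later positions and earlier entries.
  have h2 := ndetAt_eq_prod (fun p i : ℕ => if h : p < M ∧ i < M then
      shiftHom (-(p : ℂ)) ((F * gaussD s c) ⟨i, by omega⟩ ⟨p, by omega⟩) else 0)
    lam.sizeUpTo lam.monotone_sizeUpTo lam.sizeUpTo_zero (Or.inr fun r p i hp hi => by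
      split_ifs with hpi
      · rw [h.mul_apply_of_lt, map_zero]
        have hr : r < lam.length := by
          by_contra hr
          rw [lam.sizeUpTo_ofLength_le r (not_lt.1 hr)] at hp
          omega
        rw [← sizeUpTo_append_of_le M N lam nu hr.le] at hp hi
        rw [Fin.lt_def]
        refine lt_of_lt_of_le ((index_lt_iff c _ r).2 hi) (not_lt.1 fun h' => ?_)
        exact absurd ((index_lt_iff c _ r).1 h') (not_lt.2 hp)
      · rfl) lam.length
  rw [lam.sizeUpTo_length, ndetAt_eq_ndet _ rfl _ (fun p i => by
    simp only [zero_add, dif_pos (And.intro p.2 i.2)]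
    rfl)] at h2
  refine Eq.trans ?_ ((h1.symm.trans h2).trans ?_)
  · rfl
  · congr 1
    refine List.ofFn_inj.2 (funext fun a => ?_)
    rw [← shiftHom_apply, qdet_eq_ndet, map_ndet]
    refine ndetAt_eq_ndet _ (blocksFun_evenBlock M N lam nu a) _ fun p i => ?_
    have e1 := embedding_evenBlock M N lam nu a
    have e2 := blocksFun_evenBlock M N lam nu a
    have e3 := lam.sizeUpTo_le (a + 1)
    have hpi : lam.sizeUpTo a + p < M ∧ lam.sizeUpTo a + i < M := by
      have := p.2
      have := i.2
      omega
    rw [dif_pos hpi, shiftHom_shiftHom]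
    have e4 : ∀ (p : Fin (c.blocksFun (evenBlock lam nu a))) (hp), (⟨lam.sizeUpTo a + p, hp⟩ :
        Fin (M + N)) = c.embedding (evenBlock lam nu a) p := fun p _ => Fin.ext (e1 p).symm
    rw [e4, e4, h.mul_apply_of_eq (by rw [c.index_embedding, c.index_embedding]), Nat.cast_add,
      neg_add]
    rfl

/-- The odd factor of the quantum Berezinian. -/
theorem oddFactor_eq_prod :
    (∑ σ : Equiv.Perm (Fin N), Equiv.Perm.sign σ •
      (List.ofFn fun j : Fin N => shift (-(M : ℂ) + ((j : ℕ) + 1 : ℂ))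
        (tInv (stdSeq M N) (Fin.natAdd M j) (Fin.natAdd M (σ j)))).prod) =
    (List.ofFn fun b : Fin nu.length => shift (-(M : ℂ) + (nu.sizeUpTo (b + 1) : ℂ))
      (qdet (blockDInv (stdSeq M N) (lam.append nu) (oddBlock lam nu b)))).prod := by
  set s := stdSeq M N
  set c := lam.append nu with hcdef
  obtain ⟨F, E, h⟩ := exists_isGauss_gaussD s c
  have hx : tMatrix s * tInv s = 1 := (isUnit_tMatrix s).unit.mul_inv
  have hx' : tInv s * tMatrix s = 1 := (isUnit_tMatrix s).unit.inv_mul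
  have hYang : IsYang ((tInv s).submatrix (Fin.natAdd M) (Fin.natAdd M)) :=
    (isSuperYang_tMatrix s).isYang_inv hx hx' _ fun i => by simp [s, stdSeq]
  -- `Q` is the inverse of `FD`: block lower triangular, with the `D'_a` on the diagonal.
  set Q := E * tInv s
  have hQ0 : ∀ i j, c.index i < c.index j → Q i j = 0 := fun i j hij =>
    h.mul_inv_apply_of_lt (blockDInv_mul s c) c.sizeUpTo_length.symm le_rfl hx hij
  have hQ1 : ∀ a, Q.submatrix (c.embedding a) (c.embedding a) = blockDInv s c a := fun a =>
    h.mul_inv_submatrix (blockDInv_mul s c) c.sizeUpTo_length.symm le_rfl hx fun i => rfl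
  have h1 := (hYang.isManin_row (1 - M)).ndet_eq_of_add_later
    (P := fun q i => shiftHom (((q : ℕ) : ℂ) + (1 - M)) (Q (Fin.natAdd M q) (Fin.natAdd M i)))
    (fun q j => if j ≤ q then 0 else
      shiftHom (((q : ℕ) : ℂ) + (1 - M)) (E (Fin.natAdd M q) (Fin.natAdd M j)))
    (fun q j hqj => by rw [if_pos hqj]) (fun q i => by
      -- By triangularity of `E`, the odd rows of `Q` are combinations of odd rows of `T⁻¹` only, so
      -- the relations in the odd corner suffice.
      have e0 : ∀ j : Fin M, E (Fin.natAdd M q) (Fin.castAdd N j) = 0 := fun j =>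
        h.E_eq_zero_of_lt (by rw [Fin.lt_def]; simp; omega)
      rw [show Q = E * tInv s from rfl, Matrix.mul_apply, Fin.sum_univ_add]
      simp only [e0, zero_mul, Finset.sum_const_zero, zero_add]
      rw [map_sum, ← Finset.add_sum_erase _ _ (Finset.mem_univ q),
        ← Finset.add_sum_erase _ (fun j => (if j ≤ q then 0 else
          shiftHom (((q : ℕ) : ℂ) + (1 - M)) (E (Fin.natAdd M q) (Fin.natAdd M j))) * _)
          (Finset.mem_univ q),
        if_pos le_rfl, zero_mul, zero_add, h.E_diag _ _ rfl, if_pos rfl, one_mul]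
      congr 1
      refine Finset.sum_congr rfl fun j hj => ?_
      rw [map_mul]
      split_ifs with hqj
      · have hlt : Fin.natAdd M j < Fin.natAdd M q := by
          simpa using hqj.lt_of_ne (Finset.ne_of_mem_erase hj)
        rw [h.E_eq_zero_of_lt hlt, map_zero]
        rfl
      · rfl)
  have h2 := ndetAt_eq_prod (fun p i : ℕ => if h : p < N ∧ i < N then
      shiftHom ((p : ℂ) + (1 - M)) (Q ⟨M + p, by omega⟩ ⟨M + i, by omega⟩) else 0)
    nu.sizeUpTo nu.monotone_sizeUpTo nu.sizeUpTo_zero (Or.inl fun r p i hp hi => by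
      split_ifs with hpi
      · rw [hQ0, map_zero]
        rw [Fin.lt_def]
        have e := sizeUpTo_append_add M N lam nu r
        refine lt_of_lt_of_le ((index_lt_iff c _ (lam.length + r)).2 ?_) (not_lt.1 fun h' => ?_)
        · rw [e]
          simpa using hp
        · have := (index_lt_iff c _ (lam.length + r)).1 h'
          rw [e] at this
          simp at this
          omega
      · rfl) nu.length
  rw [nu.sizeUpTo_length, ndetAt_eq_ndet _ rfl _ (fun p i => by
    simp only [zero_add, dif_pos (And.intro p.2 i.2)]
    rfl)] at h2
  refine Eq.trans ?_ ((h1.symm.trans h2).trans ?_)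
  · rw [ndet]
    refine Finset.sum_congr rfl fun σ _ => ?_
    congr 2
    refine List.ofFn_inj.2 (funext fun j => ?_)
    rw [← shiftHom_apply]
    congr 2
    ring
  · congr 1
    refine List.ofFn_inj.2 (funext fun b => ?_)
    have e1 := embedding_oddBlock M N lam nu b
    have e2 : nu.sizeUpTo (b + 1) = nu.sizeUpTo b + c.blocksFun (oddBlock lam nu b) :=
      blocksFun_oddBlock M N lam nu b
    have e3 := nu.sizeUpTo_le (b + 1)
    -- The block starting at position `p_b(ν)` has row shifts beginning with `p_b(ν) + 1 - M`, while
    -- its own row determinant begins with `1 - ν_b`. The difference is `p_b(ν) + ν_b - M =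
    -- p_{b+1}(ν) - M`, which is why the end of the block appears in the odd factor.
    rw [← shiftHom_apply, (isYang_blockDInv s c fun i => ?_).qdet_eq_rowDet
      (constantCoeff_blockDInv s c _), rowDet, map_ndet]
    · refine ndetAt_eq_ndet _ (by omega) _ fun p i => ?_
      have hpi : nu.sizeUpTo b + p < N ∧ nu.sizeUpTo b + i < N := by
        have := p.2
        have := i.2
        omega
      rw [dif_pos hpi, shiftHom_shiftHom]
      have e4 : ∀ (p : Fin (c.blocksFun (oddBlock lam nu b))) (hp),
          (⟨M + (nu.sizeUpTo b + p), hp⟩ : Fin (M + N)) = c.embedding (oddBlock lam nu b) p :=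
        fun p _ => Fin.ext (by rw [e1 p, add_assoc])
      rw [e4, e4, ← hQ1, Matrix.submatrix_apply]
      congr 2
      rw [e2]
      push_cast
      ring
    · have : ¬ ((c.embedding (oddBlock lam nu b) i : ℕ) < M) := by rw [e1]; omega
      exact if_neg this

end berezinian

end SuperYangian

theorem mainTheorem3 (M N : ℕ) (lam : Composition M) (nu : Composition N) :
    SuperYangian.qsdet M N =
      (List.ofFn fun a : Fin lam.length =>
        SuperYangian.shift (-(lam.sizeUpTo a : ℂ))
          (SuperYangian.qdet
            (SuperYangian.blockD (SuperYangian.stdSeq M N) (lam.append nu)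
              (SuperYangian.evenBlock lam nu a)))).prod *
      (List.ofFn fun b : Fin nu.length =>
        SuperYangian.shift (-(M : ℂ) + (nu.sizeUpTo (b + 1) : ℂ))
          (SuperYangian.qdet
            (SuperYangian.blockDInv (SuperYangian.stdSeq M N) (lam.append nu)
              (SuperYangian.oddBlock lam nu b)))).prod := by
  rw [SuperYangian.qsdet, SuperYangian.evenFactor_eq_prod M N lam nu,
    SuperYangian.oddFactor_eq_prod M N lam nu]
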